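/- Let $\Omega=(0,1)$ and $1<s<2$, and put $\alpha=s/2\in(1/2,1)$. Let $\tilde H^{\alpha}(\Omega)$ be the space of real functions $u\in L^2(\Omega)$ whose extension by zero to $\mathbb{R}$ (again denoted $u$) lies in $H^{\alpha}(\mathbb{R})$, with the norm $$\|u\|_{\tilde H^{\alpha}(\Omega)}^2=\int_{\mathbb{R}}|u(x)|^2\,dx+\int_{\mathbb{R}}\int_{\mathbb{R}}\frac{|u(x)-u(y)|^2}{|x-y|^{1+2\alpha}}\,dx\,dy .$$ For $u\in\tilde H^{\alpha}(\Omega)$ let $${}_0D_x^{\alpha}u=\frac{d}{dx}\,\frac{1}{\Gamma(1-\alpha)}\int_0^x (x-y)^{-\alpha}u(y)\,dy,\qquad {}_xD_1^{\alpha}u=-\frac{d}{dx}\,\frac{1}{\Gamma(1-\alpha)}\int_x^1 (y-x)^{-\alpha}u(y)\,dy$$ be the left- and right-sided Riemann–Liouville derivatives, where $d/dx$ is the weak derivative on $\Omega$. Then both derivatives exist in $L^2(\Omega)$ for every $u\in\tilde H^{\alpha}(\Omega)$, and the form $$\mathcal{A}(u,v)=-\int_\Omega \big({}_0D_x^{s/2}u\big)(x)\,\big({}_xD_1^{s/2}v\big)(x)\,dx,\qquad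 u,v\in\tilde H^{s/2}(\Omega),$$ is coercive: there is a constant $c>0$, depending only on $s$, such that $$\mathcal{A}(u,u)\ \ge\ c\,\|u\|^2_{\tilde H^{s/2}(\Omega)}\qquad\text{for all }u\in\tilde H^{s/2}(\Omega).$$ Moreover $\mathcal{A}$ is monotone: $\mathcal{A}(u,u-v)-\mathcal{A}(v,u-v)\ge 0$ for all $u,v\in\tilde H^{s/2}(\Omega)$, with strict inequality whenever $u\ne v$ as elements of $\tilde H^{s/2}(\Omega)$. -/

import Mathlib

open MeasureTheory Set
open scoped ContDiff

noncomputable section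

namespace FracBVP

/-- The interior of the unit interval (the end points are a null set). -/
def Omega : Set ℝ := Ioo 0 1

/-- Left-sided fractional integral of order `β` with base point `a`. -/
def leftFracIntegral (a β : ℝ) (u : ℝ → ℝ) (x : ℝ) : ℝ :=
  1 / Real.Gamma β * ∫ y in a..x, (x - y) ^ (β - 1) * u y

/-- Right-sided fractional integral of order `β` with base point `b`. -/
def rightFracIntegral (b β : ℝ) (u : ℝ → ℝ) (x : ℝ) : ℝ :=
  1 / Real.Gamma β * ∫ y in x..b, (y - x) ^ (β - 1) * u y

/-- `g` is the weak (distributional) derivative of `F` on the open set `U`. -/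
def IsWeakDerivOn (F g : ℝ → ℝ) (U : Set ℝ) : Prop :=
  LocallyIntegrableOn F U ∧ LocallyIntegrableOn g U ∧
    ∀ φ : ℝ → ℝ, ContDiff ℝ ∞ φ → HasCompactSupport φ → tsupport φ ⊆ U →
      ∫ x in U, F x * deriv φ x = -∫ x in U, g x * φ x

/-- `g ∈ L²(0,1)` is the left-sided Riemann-Liouville derivative `D ₀I^{1-α} u` of order
`α ∈ (0,1)` on the unit interval. -/
def HasLeftRLDeriv (α : ℝ) (u g : ℝ → ℝ) : Prop :=
  MemLp g 2 (volume.restrict Omega) ∧ IsWeakDerivOn (leftFracIntegral 0 (1 - α) u) g Omega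

/-- `g ∈ L²(0,1)` is the right-sided Riemann-Liouville derivative `-D ₓI₁^{1-α} u` of order
`α ∈ (0,1)` on the unit interval. -/
def HasRightRLDeriv (α : ℝ) (u g : ℝ → ℝ) : Prop :=
  MemLp g 2 (volume.restrict Omega) ∧
    IsWeakDerivOn (rightFracIntegral 1 (1 - α) u) (fun x => -g x) Omega

open Classical in
/-- The left-sided Riemann-Liouville derivative (unique up to null sets where it exists). -/
def leftRLDeriv (α : ℝ) (u : ℝ → ℝ) : ℝ → ℝ :=
  if h : ∃ g, HasLeftRLDeriv α u g then h.choose else 0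

open Classical in
/-- The right-sided Riemann-Liouville derivative (unique up to null sets where it exists). -/
def rightRLDeriv (α : ℝ) (u : ℝ → ℝ) : ℝ → ℝ :=
  if h : ∃ g, HasRightRLDeriv α u g then h.choose else 0

/-- The integrand of the squared Slobodeckij semi-norm of order `α`. -/
def slobodeckijKernel (α : ℝ) (u : ℝ → ℝ) (p : ℝ × ℝ) : ℝ :=
  (u p.1 - u p.2) ^ 2 / |p.1 - p.2| ^ (1 + 2 * α)

/-- `u` belongs to `H̃^α(0,1)` for `α ∈ (0,1)`: it vanishes outside the unit interval (that is, it
is the extension by zero of a function on the interval) and lies in `H^α(ℝ)`. -/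
def MemHTilde (α : ℝ) (u : ℝ → ℝ) : Prop :=
  MemLp u 2 volume ∧ (∀ᵐ x, x ∉ Omega → u x = 0) ∧
    Integrable (slobodeckijKernel α u) (volume.prod volume)

/-- The norm of `H̃^α(0,1)`: the Sobolev-Slobodeckij norm on `ℝ` of the extension by zero. -/
def hTildeNorm (α : ℝ) (u : ℝ → ℝ) : ℝ :=
  Real.sqrt ((∫ x, u x ^ 2) + ∫ p, slobodeckijKernel α u p ∂(volume.prod volume))

/-- The form `A(u,v) = -(₀D^{s/2} u, ₓD₁^{s/2} v)` with the scalar product of `L²(0,1)`. -/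
def formA (s : ℝ) (u v : ℝ → ℝ) : ℝ :=
  -∫ x in Omega, leftRLDeriv (s / 2) u x * rightRLDeriv (s / 2) v x

end FracBVP

end

noncomputable section

namespace FracBVP

open Filter Topology

/-! Up to the factor `1 / Γ(1 - α)`, with `α = s / 2`, the two Riemann–Liouville derivatives are
limits in `L²(ℝ)` of regularised Marchaud integrals `∫₀^∞ α (t + ε) ^ (-1 - α) (γ 0 - γ t) dt`,
where `γ t` is the translate of `u` by `t` (left side) or by `-t` (right side). No Fourier transform
is needed: translation is isometric, so `‖γ a - γ b‖² = w (a - b)`, and polarisation writes every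
inner product of such integrals as an integral of `w` against an explicit kernel. The Slobodeckij
semi-norm is itself `2 ∫₀^∞ w h * h ^ (-1 - 2α) dh`.

For two integrals on the same side the kernel is dominated, uniformly in both regularisation
parameters, by a function whose `t`-integral is a multiple of `h ^ (-1 - 2α)`. The inner products
therefore converge and the family is Cauchy (`exists_tendsto_marchaud`). For opposite sides the
kernel of `-2⟪·, ·⟫` is the self-convolution of the Marchaud kernel minus a divergent term. An exact
integration cancels the divergence and leaves at least `2α(2α - 1)4^α h ^ (-1 - 2α)` in the limit,
which is positive because `α > 1/2` (`mixedBound_le`, `le_neg_inner_of_tendsto_marchaud`).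

Testing with smooth functions identifies the limits with the weak derivatives
(`integral_mul_eq_of_tendsto_marchaud`). The left limit vanishes on `x ≤ 0` and the right one on `x
≥ 1`, so the product over `Ω` is the inner product over `ℝ` (`formA_eq_inner`). The `L²` part of the
norm is controlled by the increments with `h > 1` (`integral_sq_le`). Monotonicity is coercivity at
`u - v`, by linearity in the first argument. -/

/-- Lebesgue measure on the positive half-line. -/
abbrev halfLine : Measure ℝ := volume.restrict (Ioi 0)

/-- The Marchaud kernel `α t ^ (-1 - α)`, shifted by `ε` to remove its singularity. -/
def shiftKernel (α ε t : ℝ) : ℝ := α * (t + ε) ^ (-1 - α)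

/-! ### Estimates for the regularised Marchaud kernel -/

section Kernel

variable {α : ℝ}

lemma measurable_shiftKernel (α ε : ℝ) : Measurable (shiftKernel α ε) := by
  unfold shiftKernel
  fun_prop

lemma shiftKernel_nonneg (hα : 0 ≤ α) {ε t : ℝ} (h : 0 ≤ t + ε) : 0 ≤ shiftKernel α ε t :=
  mul_nonneg hα (Real.rpow_nonneg h _)

lemma integrable_shiftKernel (hα : 0 < α) {ε : ℝ} (hε : 0 < ε) :
    Integrable (shiftKernel α ε) halfLine :=
  (integrableOn_add_rpow_Ioi_of_lt (by linarith) (by linarith)).const_mul α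

lemma integral_shiftKernel (hα : 0 < α) {ε : ℝ} (hε : 0 < ε) :
    ∫ t, shiftKernel α ε t ∂halfLine = ε ^ (-α) := by
  unfold shiftKernel
  rw [integral_const_mul]
  have h : ∫ t in Ioi (0 : ℝ), (t + ε) ^ (-1 - α) = ∫ t in Ioi ε, t ^ (-1 - α) := by
    have := (measurePreserving_add_right volume ε).setIntegral_preimage_emb
      (measurableEmbedding_addRight ε) (fun t : ℝ => t ^ (-1 - α)) (Ioi ε)
    simpa using this
  rw [h, integral_Ioi_rpow_of_lt (by linarith) hε]
  have : (-1 - α + 1) = -α := by ring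
  rw [this]
  field_simp

/-- Bernoulli's inequality for `a / (a + t)` with exponent `1 + α`. The gained factor `t` makes the
singularity `t ^ (-1 - α)` integrable. -/
lemma rpow_sub_rpow_add_le (hα : 0 < α) {a t : ℝ} (ha : 0 < a) (ht : 0 ≤ t) :
    a ^ (-1 - α) - (a + t) ^ (-1 - α) ≤ (1 + α) * (t * a ^ (-2 - α)) := by
  have hat : 0 < a + t := by linarith
  have hb := one_add_mul_self_le_rpow_one_add (s := a / (a + t) - 1) (p := 1 + α)
    (by have : 0 ≤ a / (a + t) := by positivity
        linarith) (by linarith)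
  have h1 : 1 + (a / (a + t) - 1) = a / (a + t) := by ring
  rw [h1, Real.div_rpow ha.le hat.le] at hb
  have h2 : a / (a + t) - 1 = - (t / (a + t)) := by field_simp; ring
  have h3 : t / (a + t) ≤ t / a := by gcongr; linarith
  have h4 : 1 - (1 + α) * (t / a) ≤ a ^ (1 + α) / (a + t) ^ (1 + α) := by
    rw [h2] at hb
    nlinarith
  have e1 : a ^ (-1 - α) = (a ^ (1 + α))⁻¹ := by
    rw [← Real.rpow_neg ha.le]; congr 1; ring
  have e2 : (a + t) ^ (-1 - α) = ((a + t) ^ (1 + α))⁻¹ := by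
    rw [← Real.rpow_neg hat.le]; congr 1; ring
  have e3 : a ^ (-2 - α) = (a ^ (1 + α))⁻¹ / a := by
    rw [← Real.rpow_neg ha.le, ← Real.rpow_sub_one ha.ne']; congr 1; ring
  rw [e1, e2, e3]
  have hp : 0 < a ^ (1 + α) := by positivity
  have h5 := mul_le_mul_of_nonneg_left h4 (inv_nonneg.2 hp.le)
  have h6 : (a ^ (1 + α))⁻¹ * (a ^ (1 + α) / (a + t) ^ (1 + α)) = ((a + t) ^ (1 + α))⁻¹ := by
    field_simp
  rw [h6] at h5
  have h7 : (a ^ (1 + α))⁻¹ * (1 - (1 + α) * (t / a)) =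
    (a ^ (1 + α))⁻¹ - (1 + α) * (t * ((a ^ (1 + α))⁻¹ / a)) := by ring
  linarith

lemma shiftKernel_sub_nonneg (hα : 0 < α) {ε h t : ℝ} (hε : 0 ≤ ε) (hh : 0 < h) (ht : 0 ≤ t) :
    0 ≤ shiftKernel α ε h - shiftKernel α ε (t + h) := by
  unfold shiftKernel
  rw [← mul_sub]
  refine mul_nonneg hα.le (sub_nonneg.2 ?_)
  exact Real.rpow_le_rpow_of_nonpos (by linarith) (by linarith) (by linarith)

/-- A majorant of `t ^ (-1 - α) * (h ^ (-1 - α) - (t + h) ^ (-1 - α))`, up to a constant. -/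
def kernelBound (α : ℝ) (p : ℝ × ℝ) : ℝ :=
  if p.1 ≤ p.2 then p.1 ^ (-α) * p.2 ^ (-2 - α) else p.1 ^ (-1 - α) * p.2 ^ (-1 - α)

lemma measurable_kernelBound (α : ℝ) : Measurable (kernelBound α) := by
  unfold kernelBound
  exact Measurable.ite (measurableSet_le measurable_fst measurable_snd) (by fun_prop) (by fun_prop)

/-- The bound is free of `ε` and `δ`, as dominated convergence requires. For `t ≤ h` the difference
is of first order in `t`; for `t > h` the subtracted term is dropped. -/
lemma shiftKernel_sub_mul_le (hα : 0 < α) {ε δ h t : ℝ} (hε : 0 ≤ ε) (hδ : 0 ≤ δ) (hh : 0 < h)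
    (ht : 0 < t) :
    (shiftKernel α ε h - shiftKernel α ε (t + h)) * shiftKernel α δ t
      ≤ α ^ 2 * (1 + α) * kernelBound α (t, h) := by
  have hb : shiftKernel α δ t ≤ α * t ^ (-1 - α) := by
    unfold shiftKernel
    gcongr 1
    exact Real.rpow_le_rpow_of_nonpos ht (by linarith) (by linarith)
  have hn := shiftKernel_sub_nonneg hα hε hh ht.le
  refine (mul_le_mul_of_nonneg_left hb hn).trans ?_
  unfold kernelBound
  have hab : shiftKernel α ε h - shiftKernel α ε (t + h)
      = α * ((h + ε) ^ (-1 - α) - (h + ε + t) ^ (-1 - α)) := by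
    unfold shiftKernel
    rw [mul_sub, add_right_comm h ε t, add_comm h t]
  have htp : 0 < t ^ (-1 - α) := by positivity
  simp only
  split_ifs with hth
  · have h1 := rpow_sub_rpow_add_le hα (a := h + ε) (by linarith) ht.le
    have h2 : (h + ε) ^ (-2 - α) ≤ h ^ (-2 - α) :=
      Real.rpow_le_rpow_of_nonpos hh (by linarith) (by linarith)
    have h3 : t ^ (-α) = t * t ^ (-1 - α) := by
      nth_rewrite 2 [← Real.rpow_one t]
      rw [← Real.rpow_add ht]; congr 1; ring
    rw [hab, h3]
    have h4 : (h + ε) ^ (-1 - α) - (h + ε + t) ^ (-1 - α) ≤ (1 + α) * (t * h ^ (-2 - α)) :=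
      h1.trans (by gcongr)
    calc α * ((h + ε) ^ (-1 - α) - (h + ε + t) ^ (-1 - α)) * (α * t ^ (-1 - α))
        ≤ α * ((1 + α) * (t * h ^ (-2 - α))) * (α * t ^ (-1 - α)) := by gcongr
      _ = _ := by ring
  · have h4 : (h + ε) ^ (-1 - α) - (h + ε + t) ^ (-1 - α) ≤ h ^ (-1 - α) := by
      have h2 : (h + ε) ^ (-1 - α) ≤ h ^ (-1 - α) :=
        Real.rpow_le_rpow_of_nonpos hh (by linarith) (by linarith)
      have h5 : 0 ≤ (h + ε + t) ^ (-1 - α) := by positivity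
      linarith
    rw [hab]
    have hh' : 0 < h ^ (-1 - α) := by positivity
    calc α * ((h + ε) ^ (-1 - α) - (h + ε + t) ^ (-1 - α)) * (α * t ^ (-1 - α))
        ≤ α * (h ^ (-1 - α)) * (α * t ^ (-1 - α)) := by gcongr
      _ = α ^ 2 * 1 * (t ^ (-1 - α) * h ^ (-1 - α)) := by ring
      _ ≤ α ^ 2 * (1 + α) * (t ^ (-1 - α) * h ^ (-1 - α)) := by gcongr; linarith

lemma kernelBound_nonneg {p : ℝ × ℝ} (h1 : 0 ≤ p.1) (h2 : 0 ≤ p.2) : 0 ≤ kernelBound α p := by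
  unfold kernelBound
  split_ifs <;> positivity

/-- The power `h ^ (-1 - 2 * α)` is the weight of the Slobodeckij semi-norm. Integrability near `0`
uses `α < 1`, at infinity `0 < α`. -/
lemma integrable_kernelBound_left (hα : 0 < α) (hα1 : α < 1) {h : ℝ} (hh : 0 < h) :
    Integrable (fun t => kernelBound α (t, h)) halfLine ∧
      ∫ t, kernelBound α (t, h) ∂halfLine = (1 / (1 - α) + 1 / α) * h ^ (-1 - 2 * α) := by
  have i1 : IntegrableOn (fun t => kernelBound α (t, h)) (Ioc 0 h) := by
    have : IntegrableOn (fun t : ℝ => t ^ (-α) * h ^ (-2 - α)) (Ioc 0 h) := by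
      have := (intervalIntegral.intervalIntegrable_rpow' (a := 0) (b := h) (r := -α)
        (by linarith)).mul_const (h ^ (-2 - α))
      rwa [intervalIntegrable_iff_integrableOn_Ioc_of_le hh.le] at this
    refine this.congr_fun (fun t ht => ?_) measurableSet_Ioc
    simp [kernelBound, ht.2]
  have i2 : IntegrableOn (fun t => kernelBound α (t, h)) (Ioi h) := by
    have : IntegrableOn (fun t : ℝ => t ^ (-1 - α) * h ^ (-1 - α)) (Ioi h) :=
      (integrableOn_Ioi_rpow_of_lt (by linarith) hh).mul_const _
    refine this.congr_fun (fun t ht => ?_) measurableSet_Ioi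
    simp [kernelBound, not_le.2 (mem_Ioi.1 ht)]
  refine ⟨?_, ?_⟩
  · have := i1.union i2
    rwa [Ioc_union_Ioi_eq_Ioi hh.le] at this
  · rw [halfLine, ← Ioc_union_Ioi_eq_Ioi hh.le, setIntegral_union (Ioc_disjoint_Ioi le_rfl)
      measurableSet_Ioi i1 i2]
    have e1 : ∫ t in Ioc 0 h, kernelBound α (t, h) = ∫ t in Ioc 0 h, t ^ (-α) * h ^ (-2 - α) :=
      setIntegral_congr_fun measurableSet_Ioc (fun t ht => by simp [kernelBound, ht.2])
    have e2 : ∫ t in Ioi h, kernelBound α (t, h) = ∫ t in Ioi h, t ^ (-1 - α) * h ^ (-1 - α) :=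
      setIntegral_congr_fun measurableSet_Ioi
        (fun t ht => by simp [kernelBound, not_le.2 (mem_Ioi.1 ht)])
    rw [e1, e2, integral_mul_const, integral_mul_const, ← intervalIntegral.integral_of_le hh.le,
      integral_rpow (Or.inl (by linarith)), integral_Ioi_rpow_of_lt (by linarith) hh,
      Real.zero_rpow (by linarith)]
    have e3 : h ^ (-1 - 2 * α) = h ^ (-α + 1) * h ^ (-2 - α) := by
      rw [← Real.rpow_add hh]; congr 1; ring
    have e4 : h ^ (-1 - 2 * α) = h ^ (-1 - α + 1) * h ^ (-1 - α) := by
      rw [← Real.rpow_add hh]; congr 1; ring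
    rw [add_mul]
    nth_rewrite 1 [e3]
    rw [e4]
    have : -1 - α + 1 = -α := by ring
    have h' : -α + 1 = 1 - α := by ring
    rw [this, h']
    field_simp
    ring

end Kernel

/-! ### Changes of variables in the quadrant -/

section Shear

/-- The integral over a triangle `0 < t < h` in terms of an integral over a quadrant. -/
lemma setIntegral_shear (k : ℝ × ℝ → ℝ) :
    ∫ p, k (p.1, p.1 + p.2) ∂(halfLine.prod halfLine)
      = ∫ p in {p : ℝ × ℝ | 0 < p.1 ∧ p.1 < p.2}, k p := by
  have hmp := measurePreserving_prod_add (volume : Measure ℝ) (volume : Measure ℝ)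
  have he : MeasurableEmbedding (fun z : ℝ × ℝ => (z.1, z.1 + z.2)) :=
    (MeasurableEquiv.shearAddRight ℝ).measurableEmbedding
  have := hmp.setIntegral_preimage_emb he k {p : ℝ × ℝ | 0 < p.1 ∧ p.1 < p.2}
  rw [Measure.volume_eq_prod, ← this, Measure.prod_restrict]
  congr 2
  ext p
  simp

lemma integrable_shear_iff (k : ℝ × ℝ → ℝ) :
    Integrable (fun p => k (p.1, p.1 + p.2)) (halfLine.prod halfLine)
      ↔ IntegrableOn k {p : ℝ × ℝ | 0 < p.1 ∧ p.1 < p.2} := by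
  have hmp := measurePreserving_prod_add (volume : Measure ℝ) (volume : Measure ℝ)
  have he : MeasurableEmbedding (fun z : ℝ × ℝ => (z.1, z.1 + z.2)) :=
    (MeasurableEquiv.shearAddRight ℝ).measurableEmbedding
  have := hmp.integrableOn_comp_preimage he (f := k) (s := {p : ℝ × ℝ | 0 < p.1 ∧ p.1 < p.2})
  rw [Measure.volume_eq_prod, ← this, Measure.prod_restrict]
  have hs : Ioi (0 : ℝ) ×ˢ Ioi (0 : ℝ) = (fun z : ℝ × ℝ => (z.1, z.1 + z.2)) ⁻¹'
      {p : ℝ × ℝ | 0 < p.1 ∧ p.1 < p.2} := by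
    ext p
    simp
  rw [hs]
  rfl

lemma integrable_shear {k : ℝ × ℝ → ℝ} (hk : Integrable k (halfLine.prod halfLine)) :
    Integrable (fun p => k (p.1, p.1 + p.2)) (halfLine.prod halfLine) := by
  rw [integrable_shear_iff]
  rw [Measure.prod_restrict] at hk
  exact IntegrableOn.mono_set hk (fun p hp => ⟨hp.1, hp.1.trans hp.2⟩)

lemma volume_diagonal : (volume : Measure (ℝ × ℝ)) {p | p.1 = p.2} = 0 := by
  have hm : MeasurableSet {p : ℝ × ℝ | p.1 = p.2} :=
    measurableSet_eq_fun measurable_fst measurable_snd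
  rw [Measure.volume_eq_prod, Measure.measure_prod_null hm]
  refine Eventually.of_forall fun x => ?_
  have : Prod.mk x ⁻¹' {p : ℝ × ℝ | p.1 = p.2} = {x} := by ext y; simp [eq_comm]
  simp [this]

/-- The integral over a quadrant, split along the diagonal. -/
lemma integral_quadrant_eq {k : ℝ × ℝ → ℝ} (hk : Integrable k (halfLine.prod halfLine)) :
    ∫ p, k p ∂(halfLine.prod halfLine)
      = ∫ p, k (p.1, p.1 + p.2) ∂(halfLine.prod halfLine)
        + ∫ p, k (p.1 + p.2, p.1) ∂(halfLine.prod halfLine) := by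
  have e2 := setIntegral_shear (fun p => k p.swap)
  simp only [Prod.swap_prod_mk] at e2
  rw [setIntegral_shear, e2]
  have hA : MeasurableSet {p : ℝ × ℝ | p.1 < p.2} := measurableSet_lt measurable_fst measurable_snd
  rw [← integral_add_compl hA hk]
  congr 1
  · rw [Measure.prod_restrict, Measure.restrict_restrict hA, ← Measure.volume_eq_prod]
    congr 2
    ext p
    simp only [mem_inter_iff, mem_ofPred_eq, mem_prod, mem_Ioi]
    exact ⟨fun h => ⟨h.2.1, h.1⟩, fun h => ⟨h.2, h.1, h.1.trans h.2⟩⟩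
  · have hsw := (Measure.measurePreserving_swap (μ := (volume : Measure ℝ))
      (ν := (volume : Measure ℝ))).setIntegral_preimage_emb
      MeasurableEquiv.prodComm.measurableEmbedding k {p : ℝ × ℝ | 0 < p.2 ∧ p.2 < p.1}
    have hpre : Prod.swap ⁻¹' {p : ℝ × ℝ | 0 < p.2 ∧ p.2 < p.1}
        = {p : ℝ × ℝ | 0 < p.1 ∧ p.1 < p.2} := rfl
    rw [hpre] at hsw
    rw [Measure.prod_restrict, Measure.restrict_restrict hA.compl, ← Measure.volume_eq_prod]
    rw [← Measure.volume_eq_prod] at hsw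
    rw [hsw]
    -- The two regions differ only by the diagonal, a null set.
    refine setIntegral_congr_set ?_
    have hd : ∀ᵐ p : ℝ × ℝ, p.1 ≠ p.2 := by
      rw [ae_iff]
      simpa using volume_diagonal
    filter_upwards [hd] with p hp
    refine propext ⟨fun h => ?_, fun h => ?_⟩
    · exact ⟨h.2.2, lt_of_le_of_ne (not_lt.1 h.1) hp.symm⟩
    · exact ⟨not_lt.2 h.2.le, h.1.trans h.2, h.1⟩

end Shear

/-! ### Convergence of regularised Marchaud derivatives of stationary curves -/

section StationaryCurve

variable {H : Type*} [NormedAddCommGroup H]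

/-- A bounded continuous curve in a Hilbert space with stationary increments of size `w`. -/
structure IsStationaryCurve (γ : ℝ → H) (w : ℝ → ℝ) : Prop where
  continuous : Continuous γ
  bounded : ∃ M, ∀ t, ‖γ t‖ ≤ M
  norm_sub_sq : ∀ a b, ‖γ a - γ b‖ ^ 2 = w (a - b)

namespace IsStationaryCurve

variable {γ : ℝ → H} {w : ℝ → ℝ}

lemma eq_norm (hγ : IsStationaryCurve γ w) (t : ℝ) : w t = ‖γ t - γ 0‖ ^ 2 := by
  rw [hγ.norm_sub_sq, sub_zero]

lemma nonneg (hγ : IsStationaryCurve γ w) (t : ℝ) : 0 ≤ w t := by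
  rw [hγ.eq_norm]; positivity

lemma even (hγ : IsStationaryCurve γ w) (t : ℝ) : w (-t) = w t := by
  rw [hγ.eq_norm t, norm_sub_rev, hγ.norm_sub_sq, zero_sub]

lemma continuous_incr (hγ : IsStationaryCurve γ w) : Continuous w := by
  have : w = fun t => ‖γ t - γ 0‖ ^ 2 := funext hγ.eq_norm
  rw [this]
  have := hγ.continuous
  fun_prop

lemma bounded_incr (hγ : IsStationaryCurve γ w) : ∃ M, ∀ t, ‖w t‖ ≤ M := by
  obtain ⟨M, hM⟩ := hγ.bounded
  refine ⟨(M + M) ^ 2, fun t => ?_⟩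
  rw [Real.norm_of_nonneg (hγ.nonneg t), hγ.eq_norm]
  gcongr
  exact (norm_sub_le _ _).trans (add_le_add (hM _) (hM _))

lemma comp_neg (hγ : IsStationaryCurve γ w) : IsStationaryCurve (fun t => γ (-t)) w where
  continuous := hγ.continuous.comp continuous_neg
  bounded := hγ.bounded.imp fun _ h t => h (-t)
  norm_sub_sq a b := by
    rw [hγ.norm_sub_sq, ← hγ.even]
    congr 1
    ring

variable [InnerProductSpace ℝ H]

/-- Polarisation. From here on all inner products depend on `w` alone. -/
lemma inner_sub_sub (hγ : IsStationaryCurve γ w) (t τ : ℝ) :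
    inner ℝ (γ 0 - γ t) (γ 0 - γ τ) = (w t + w τ - w (t - τ)) / 2 := by
  have h := norm_sub_sq_real (γ 0 - γ t) (γ 0 - γ τ)
  have e : (γ 0 - γ t) - (γ 0 - γ τ) = γ τ - γ t := by abel
  rw [e, norm_sub_rev, hγ.norm_sub_sq, norm_sub_rev (γ 0) (γ t), norm_sub_rev (γ 0) (γ τ),
    ← hγ.eq_norm, ← hγ.eq_norm] at h
  linarith

end IsStationaryCurve

variable [InnerProductSpace ℝ H]

/-- The regularised Marchaud derivative at the origin of a curve. -/
def marchaud (α : ℝ) (γ : ℝ → H) (ε : ℝ) : H :=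
  ∫ t, shiftKernel α ε t • (γ 0 - γ t) ∂halfLine

lemma integrable_shiftKernel_smul {α ε : ℝ} (hα : 0 < α) (hε : 0 < ε) {f : ℝ → H}
    (hf : Continuous f) (hb : ∃ M, ∀ t, ‖f t‖ ≤ M) :
    Integrable (fun t => shiftKernel α ε t • f t) halfLine := by
  obtain ⟨M, hM⟩ := hb
  have hi := integrable_shiftKernel hα hε
  refine (hi.norm.mul_const M).mono' (hi.aestronglyMeasurable.smul hf.aestronglyMeasurable)
    (Eventually.of_forall fun t => ?_)
  rw [norm_smul]
  gcongr
  exact hM t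

lemma integrable_shiftKernel_mul_mul {α ε δ : ℝ} (hα : 0 < α) (hε : 0 < ε) (hδ : 0 < δ)
    {b : ℝ × ℝ → ℝ} (hb : Continuous b) (hM : ∃ M, ∀ p, ‖b p‖ ≤ M) :
    Integrable (fun p : ℝ × ℝ => shiftKernel α ε p.1 * shiftKernel α δ p.2 * b p)
      (halfLine.prod halfLine) := by
  obtain ⟨M, hM⟩ := hM
  exact ((integrable_shiftKernel hα hε).mul_prod (integrable_shiftKernel hα hδ)).mul_bdd
    hb.aestronglyMeasurable (Eventually.of_forall hM)

lemma integral_mul_half_add_sub {X : Type*} [MeasurableSpace X] {μ : Measure X}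
    {k a b c : X → ℝ} (ha : Integrable (fun p => k p * a p) μ)
    (hb : Integrable (fun p => k p * b p) μ) (hc : Integrable (fun p => k p * c p) μ) :
    ∫ p, k p * ((a p + b p - c p) / 2) ∂μ
      = ((∫ p, k p * a p ∂μ) + (∫ p, k p * b p ∂μ) - ∫ p, k p * c p ∂μ) / 2 := by
  have hab : Integrable (fun p => k p * a p + k p * b p) μ := ha.add hb
  rw [← integral_add ha hb, ← integral_sub hab hc, ← integral_div]
  refine integral_congr_ae (Eventually.of_forall fun p => ?_)
  simp only
  ring

section Inner

variable {γ : ℝ → H} {w : ℝ → ℝ}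

lemma IsStationaryCurve.integrable (hγ : IsStationaryCurve γ w) {α ε : ℝ} (hα : 0 < α)
    (hε : 0 < ε) : Integrable (fun t => shiftKernel α ε t • (γ 0 - γ t)) halfLine := by
  refine integrable_shiftKernel_smul hα hε (continuous_const.sub hγ.continuous) ?_
  obtain ⟨M, hM⟩ := hγ.bounded
  exact ⟨M + M, fun t => (norm_sub_le _ _).trans (add_le_add (hM _) (hM _))⟩

variable [CompleteSpace H]

lemma inner_marchaud (hγ : IsStationaryCurve γ w) {α ε : ℝ} (hα : 0 < α) (hε : 0 < ε) (v : H) :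
    inner ℝ v (marchaud α γ ε) = ∫ t, shiftKernel α ε t * inner ℝ v (γ 0 - γ t) ∂halfLine := by
  rw [marchaud, ← integral_inner (hγ.integrable hα hε)]
  simp only [inner_smul_right]

lemma inner_marchaud_marchaud {γ₁ γ₂ : ℝ → H} (h₁ : IsStationaryCurve γ₁ w)
    (h₂ : IsStationaryCurve γ₂ w) {α ε δ : ℝ} (hα : 0 < α) (hε : 0 < ε) (hδ : 0 < δ) :
    inner ℝ (marchaud α γ₁ ε) (marchaud α γ₂ δ)
      = ∫ p, shiftKernel α ε p.1 * shiftKernel α δ p.2 *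
          inner ℝ (γ₁ 0 - γ₁ p.1) (γ₂ 0 - γ₂ p.2) ∂(halfLine.prod halfLine) := by
  have c₁ := h₁.continuous
  have c₂ := h₂.continuous
  obtain ⟨M₁, hM₁⟩ := h₁.bounded
  obtain ⟨M₂, hM₂⟩ := h₂.bounded
  rw [integral_prod _ (integrable_shiftKernel_mul_mul hα hε hδ (by fun_prop)
    ⟨(M₁ + M₁) * (M₂ + M₂), fun p => ?_⟩)]
  · rw [real_inner_comm, inner_marchaud h₁ hα hε]
    refine integral_congr_ae (Eventually.of_forall fun t => ?_)
    simp only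
    rw [real_inner_comm, inner_marchaud h₂ hα hδ, ← integral_const_mul]
    simp only [mul_assoc]
  · have a₁ := (norm_sub_le (γ₁ 0) (γ₁ p.1)).trans (add_le_add (hM₁ _) (hM₁ _))
    have a₂ := (norm_sub_le (γ₂ 0) (γ₂ p.2)).trans (add_le_add (hM₂ _) (hM₂ _))
    refine (norm_inner_le_norm _ _).trans ?_
    exact mul_le_mul a₁ a₂ (norm_nonneg _) ((norm_nonneg _).trans a₁)

/-- One half of the expansion of `⟪marchaud α γ ε, marchaud α γ δ⟫` in terms of increments. -/
def incrForm (α : ℝ) (w : ℝ → ℝ) (ε δ : ℝ) : ℝ :=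
  ∫ p, w p.2 * ((shiftKernel α ε p.2 - shiftKernel α ε (p.1 + p.2)) * shiftKernel α δ p.1)
    ∂(halfLine.prod halfLine)

/-- Polarisation produces `w t`, `w τ` and `w (t - τ)`. The last is split along the diagonal, and on
each half `|t - τ|` becomes the new variable `h`. Pairing each half with one of the other two terms
yields the difference of kernels in `incrForm`, which tames the singularity at `t = 0`. -/
lemma inner_marchaud_self (hγ : IsStationaryCurve γ w) {α ε δ : ℝ} (hα : 0 < α) (hε : 0 < ε)
    (hδ : 0 < δ) :
    inner ℝ (marchaud α γ ε) (marchaud α γ δ)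
      = (incrForm α w ε δ + incrForm α w δ ε) / 2 := by
  have cw := hγ.continuous_incr
  obtain ⟨M, hM⟩ := hγ.bounded_incr
  rw [inner_marchaud_marchaud hγ hγ hα hε hδ]
  simp only [hγ.inner_sub_sub]
  have I : ∀ {ε δ : ℝ}, 0 < ε → 0 < δ → ∀ f : ℝ × ℝ → ℝ, Continuous f →
      Integrable (fun p : ℝ × ℝ => shiftKernel α ε p.1 * shiftKernel α δ p.2 * w (f p))
        (halfLine.prod halfLine) := fun hε hδ f hf =>
    integrable_shiftKernel_mul_mul hα hε hδ (cw.comp hf) ⟨M, fun p => hM (f p)⟩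
  have i1 := I hε hδ (fun p => p.1) continuous_fst
  have i2 := I hε hδ (fun p => p.2) continuous_snd
  have i3 := I hε hδ (fun p => p.1 - p.2) (continuous_fst.sub continuous_snd)
  have i1' := I hδ hε (fun p => p.2) continuous_snd
  have i3a := integrable_shear i3
  have i3b : Integrable (fun p : ℝ × ℝ => shiftKernel α ε (p.1 + p.2) * shiftKernel α δ p.1 *
      w (p.1 + p.2 - p.1)) (halfLine.prod halfLine) := integrable_shear i3.swap
  have e3 := integral_quadrant_eq i3
  have e1 : ∫ p : ℝ × ℝ, shiftKernel α ε p.1 * shiftKernel α δ p.2 * w p.1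
      ∂(halfLine.prod halfLine)
      = ∫ p : ℝ × ℝ, shiftKernel α δ p.1 * shiftKernel α ε p.2 * w p.2
      ∂(halfLine.prod halfLine) := by
    rw [← integral_prod_swap]
    refine integral_congr_ae (Eventually.of_forall fun p => ?_)
    simp only [Prod.fst_swap, Prod.snd_swap]
    ring
  have hsplit : ∫ p : ℝ × ℝ, shiftKernel α ε p.1 * shiftKernel α δ p.2 *
      ((w p.1 + w p.2 - w (p.1 - p.2)) / 2) ∂(halfLine.prod halfLine)
      = ((∫ p : ℝ × ℝ, shiftKernel α ε p.1 * shiftKernel α δ p.2 * w p.1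
        ∂(halfLine.prod halfLine))
        + (∫ p : ℝ × ℝ, shiftKernel α ε p.1 * shiftKernel α δ p.2 * w p.2
        ∂(halfLine.prod halfLine))
        - ∫ p : ℝ × ℝ, shiftKernel α ε p.1 * shiftKernel α δ p.2 * w (p.1 - p.2)
        ∂(halfLine.prod halfLine)) / 2 := by
    exact integral_mul_half_add_sub i1 i2 i3
  rw [hsplit, e3, e1]
  have f1 : incrForm α w ε δ
      = (∫ p : ℝ × ℝ, shiftKernel α δ p.1 * shiftKernel α ε p.2 * w p.2
        ∂(halfLine.prod halfLine)) - ∫ p : ℝ × ℝ, shiftKernel α ε (p.1 + p.2) *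
          shiftKernel α δ p.1 * w (p.1 + p.2 - p.1) ∂(halfLine.prod halfLine) := by
    rw [← integral_sub i1' i3b]
    refine integral_congr_ae (Eventually.of_forall fun p => ?_)
    simp only [add_sub_cancel_left]
    ring
  have f2 : incrForm α w δ ε
      = (∫ p : ℝ × ℝ, shiftKernel α ε p.1 * shiftKernel α δ p.2 * w p.2
        ∂(halfLine.prod halfLine)) - ∫ p : ℝ × ℝ, shiftKernel α ε p.1 *
          shiftKernel α δ (p.1 + p.2) * w (p.1 - (p.1 + p.2)) ∂(halfLine.prod halfLine) := by
    rw [← integral_sub i2 i3a]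
    refine integral_congr_ae (Eventually.of_forall fun p => ?_)
    simp only [sub_add_cancel_left, hγ.even]
    ring
  rw [f1, f2]
  ring

lemma integrable_mul_kernelBound {α : ℝ} (hα : 0 < α) (hα1 : α < 1) (hw : Measurable w)
    (hi : Integrable (fun h => w h * h ^ (-1 - 2 * α)) halfLine) :
    Integrable (fun p : ℝ × ℝ => w p.2 * kernelBound α p) (halfLine.prod halfLine) := by
  have hm : Measurable (fun p : ℝ × ℝ => w p.2 * kernelBound α p) :=
    (hw.comp measurable_snd).mul (measurable_kernelBound α)
  rw [integrable_prod_iff' hm.aestronglyMeasurable]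
  constructor
  · filter_upwards [ae_restrict_mem measurableSet_Ioi] with h hh
    exact (integrable_kernelBound_left hα hα1 hh).1.const_mul _
  · refine (hi.norm.const_mul (1 / (1 - α) + 1 / α)).congr ?_
    filter_upwards [ae_restrict_mem measurableSet_Ioi] with h hh
    have hh' : 0 < h := hh
    have : ∫ t, ‖w h * kernelBound α (t, h)‖ ∂halfLine
        = ‖w h‖ * ∫ t, kernelBound α (t, h) ∂halfLine := by
      rw [← integral_const_mul]
      refine integral_congr_ae ?_
      filter_upwards [ae_restrict_mem measurableSet_Ioi] with t ht
      rw [norm_mul, Real.norm_of_nonneg (kernelBound_nonneg (p := (t, h)) (le_of_lt ht) hh'.le)]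
    rw [this, (integrable_kernelBound_left hα hα1 hh).2, norm_mul,
      Real.norm_of_nonneg (Real.rpow_nonneg hh'.le _)]
    ring

lemma tendsto_shiftKernel {α t : ℝ} (ht : 0 < t) :
    Tendsto (fun ε => shiftKernel α ε t) (𝓝[>] 0) (𝓝 (shiftKernel α 0 t)) := by
  have : ContinuousAt (fun ε => shiftKernel α ε t) 0 := by
    unfold shiftKernel
    refine continuousAt_const.mul (ContinuousAt.rpow_const (by fun_prop) (Or.inl ?_))
    simpa using ht.ne'
  exact this.tendsto.mono_left nhdsWithin_le_nhds

/-- The two parameters tend to `0` independently, because the Cauchy criterion compares different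
regularisations. -/
lemma tendsto_incrForm {α : ℝ} (hα : 0 < α) (hα1 : α < 1) (hw : Measurable w)
    (hw0 : ∀ h, 0 ≤ w h) (hi : Integrable (fun h => w h * h ^ (-1 - 2 * α)) halfLine) :
    Tendsto (fun q : ℝ × ℝ => incrForm α w q.1 q.2) (𝓝[>] 0 ×ˢ 𝓝[>] 0)
      (𝓝 (incrForm α w 0 0)) := by
  have hev : ∀ᶠ q : ℝ × ℝ in 𝓝[>] (0 : ℝ) ×ˢ 𝓝[>] (0 : ℝ), 0 < q.1 ∧ 0 < q.2 :=
    Filter.Eventually.prod_mk self_mem_nhdsWithin self_mem_nhdsWithin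
  have hQ : ∀ᵐ p : ℝ × ℝ ∂(halfLine.prod halfLine), 0 < p.1 ∧ 0 < p.2 := by
    rw [Measure.prod_restrict]
    exact ae_restrict_mem (measurableSet_Ioi.prod measurableSet_Ioi)
  refine tendsto_integral_filter_of_dominated_convergence
    (fun p => α ^ 2 * (1 + α) * (w p.2 * kernelBound α p)) (Eventually.of_forall fun q => ?_) ?_
    ((integrable_mul_kernelBound hα hα1 hw hi).const_mul _) ?_
  · have h1 := measurable_shiftKernel α q.1
    have h2 := measurable_shiftKernel α q.2
    exact Measurable.aestronglyMeasurable (by fun_prop)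
  · filter_upwards [hev] with q hq
    filter_upwards [hQ] with p hp
    have hn := mul_nonneg (shiftKernel_sub_nonneg hα hq.1.le hp.2 hp.1.le)
      (shiftKernel_nonneg (ε := q.2) (t := p.1) hα.le (by linarith))
    rw [Real.norm_of_nonneg (mul_nonneg (hw0 _) hn), mul_left_comm (α ^ 2 * (1 + α))]
    exact mul_le_mul_of_nonneg_left (shiftKernel_sub_mul_le hα hq.1.le hq.2.le hp.2 hp.1) (hw0 _)
  · filter_upwards [hQ] with p hp
    refine Tendsto.const_mul _ (Tendsto.mul (Tendsto.sub ?_ ?_) ?_)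
    · exact (tendsto_shiftKernel hp.2).comp tendsto_fst
    · exact (tendsto_shiftKernel (add_pos hp.1 hp.2)).comp tendsto_fst
    · exact (tendsto_shiftKernel hp.1).comp tendsto_snd

/-- Expanding `‖f a - f b‖²` gives three inner products with joint limit `N - 2N + N = 0`, so `f` is
Cauchy. -/
lemma exists_tendsto_of_tendsto_inner {ι : Type*} {l : Filter ι} [l.NeBot] {f : ι → H} {N : ℝ}
    (h : Tendsto (fun q : ι × ι => (inner ℝ (f q.1) (f q.2) : ℝ)) (l ×ˢ l) (𝓝 N)) :
    ∃ G : H, Tendsto f l (𝓝 G) := by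
  rw [← cauchy_map_iff_exists_tendsto, cauchy_map_iff, tendsto_uniformity_iff_dist_tendsto_zero]
  refine ⟨inferInstance, ?_⟩
  have h11 : Tendsto (fun q : ι × ι => (inner ℝ (f q.1) (f q.1) : ℝ)) (l ×ˢ l) (𝓝 N) :=
    h.comp ((tendsto_fst (f := l) (g := l)).prodMk (tendsto_fst (f := l) (g := l)))
  have h22 : Tendsto (fun q : ι × ι => (inner ℝ (f q.2) (f q.2) : ℝ)) (l ×ˢ l) (𝓝 N) :=
    h.comp ((tendsto_snd (f := l) (g := l)).prodMk (tendsto_snd (f := l) (g := l)))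
  have hsq : Tendsto (fun q : ι × ι => ‖f q.1 - f q.2‖ ^ 2) (l ×ˢ l) (𝓝 0) := by
    have h3 := (h11.sub (h.const_mul 2)).add h22
    rw [show N - 2 * N + N = 0 by ring] at h3
    refine h3.congr fun q => ?_
    rw [norm_sub_sq_real, ← real_inner_self_eq_norm_sq, ← real_inner_self_eq_norm_sq]
  have hs := hsq.sqrt
  simp only [Real.sqrt_zero, Real.sqrt_sq (norm_nonneg _)] at hs
  simpa only [dist_eq_norm] using hs

/-- The regularised Marchaud derivatives converge. -/
theorem exists_tendsto_marchaud (hγ : IsStationaryCurve γ w) {α : ℝ} (hα : 0 < α) (hα1 : α < 1)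
    (hi : Integrable (fun h => w h * h ^ (-1 - 2 * α)) halfLine) :
    ∃ G : H, Tendsto (fun ε => marchaud α γ ε) (𝓝[>] 0) (𝓝 G) := by
  have hT := tendsto_incrForm hα hα1 hγ.continuous_incr.measurable hγ.nonneg hi
  have hS : Tendsto (fun q : ℝ × ℝ => incrForm α w q.2 q.1) (𝓝[>] 0 ×ˢ 𝓝[>] 0)
      (𝓝 (incrForm α w 0 0)) := by
    generalize incrForm α w = F at hT ⊢
    exact hT.comp (tendsto_snd.prodMk tendsto_fst)
  have hev : ∀ᶠ q : ℝ × ℝ in 𝓝[>] (0 : ℝ) ×ˢ 𝓝[>] (0 : ℝ), 0 < q.1 ∧ 0 < q.2 :=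
    Filter.Eventually.prod_mk self_mem_nhdsWithin self_mem_nhdsWithin
  refine exists_tendsto_of_tendsto_inner (((hT.add hS).div_const 2).congr' ?_)
  filter_upwards [hev] with q hq
  exact (inner_marchaud_self hγ hα hq.1 hq.2).symm

end Inner

end StationaryCurve

/-! ### Lower bound for the kernel of the mixed product -/

section MixedKernel

variable {α : ℝ}

/-- A lower bound of the kernel of `-2 ⟪marchaud α γ ε, marchaud α γ(-·) ε⟫`. -/
def mixedBound (α ε h : ℝ) : ℝ :=
  2 * α * (2 * α - 1) * 4 ^ α * (h * (h + 2 * ε) ^ (-2 - 2 * α))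
    - 8 * α * (ε ^ (1 - α) * (h + ε) ^ (-2 - α))

lemma measurable_mixedBound (α ε : ℝ) : Measurable (mixedBound α ε) := by
  unfold mixedBound
  fun_prop

/-- Domination by the semi-norm weight, uniform in `ε`; the correction term is handled by `ε ^ (1 -
α) ≤ (h + ε) ^ (1 - α)`. -/
lemma abs_mixedBound_le (hα : 1 / 2 < α) (hα1 : α < 1) {ε h : ℝ} (hε : 0 < ε) (hh : 0 < h) :
    |mixedBound α ε h| ≤ (2 * α * (2 * α - 1) * 4 ^ α + 8 * α) * h ^ (-1 - 2 * α) := by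
  have hα0 : 0 < α := by linarith
  have h21 : 0 < 2 * α - 1 := by linarith
  have b1 : h * (h + 2 * ε) ^ (-2 - 2 * α) ≤ h ^ (-1 - 2 * α) := by
    calc h * (h + 2 * ε) ^ (-2 - 2 * α) ≤ h * h ^ (-2 - 2 * α) := by
          gcongr 1
          exact Real.rpow_le_rpow_of_nonpos hh (by linarith) (by linarith)
      _ = h ^ (-1 - 2 * α) := by
          nth_rewrite 1 [← Real.rpow_one h]
          rw [← Real.rpow_add hh]; congr 1; ring
  have b2 : ε ^ (1 - α) * (h + ε) ^ (-2 - α) ≤ h ^ (-1 - 2 * α) := by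
    calc ε ^ (1 - α) * (h + ε) ^ (-2 - α) ≤ (h + ε) ^ (1 - α) * (h + ε) ^ (-2 - α) := by
          gcongr
          linarith
      _ = (h + ε) ^ (-1 - 2 * α) := by
          rw [← Real.rpow_add (by positivity)]; congr 1; ring
      _ ≤ h ^ (-1 - 2 * α) :=
          Real.rpow_le_rpow_of_nonpos hh (by linarith) (by linarith)
  have p1 : 0 ≤ h * (h + 2 * ε) ^ (-2 - 2 * α) := by positivity
  have p2 : 0 ≤ ε ^ (1 - α) * (h + ε) ^ (-2 - α) := by positivity
  have c1 : 0 ≤ 2 * α * (2 * α - 1) * 4 ^ α := by positivity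
  unfold mixedBound
  rw [abs_le]
  constructor <;>
    nlinarith [mul_le_mul_of_nonneg_left b1 c1, mul_le_mul_of_nonneg_left b2 hα0.le,
      mul_nonneg c1 p1, mul_nonneg hα0.le p2]

lemma tendsto_mixedBound (hα1 : α < 1) {h : ℝ} (hh : 0 < h) :
    Tendsto (fun ε => mixedBound α ε h) (𝓝[>] 0)
      (𝓝 (2 * α * (2 * α - 1) * 4 ^ α * h ^ (-1 - 2 * α))) := by
  have hc : ContinuousAt (fun ε => mixedBound α ε h) 0 := by
    unfold mixedBound
    refine ContinuousAt.sub (continuousAt_const.mul (continuousAt_const.mul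
      (ContinuousAt.rpow_const (by fun_prop) (Or.inl ?_))))
      (continuousAt_const.mul (ContinuousAt.mul
        (ContinuousAt.rpow_const (by fun_prop) (Or.inr (by linarith)))
        (ContinuousAt.rpow_const (by fun_prop) (Or.inl ?_))))
    · simpa using hh.ne'
    · simpa using hh.ne'
  have h0 : mixedBound α 0 h = 2 * α * (2 * α - 1) * 4 ^ α * h ^ (-1 - 2 * α) := by
    unfold mixedBound
    rw [Real.zero_rpow (by linarith), mul_zero, add_zero, zero_mul, mul_zero, sub_zero]
    congr 1
    nth_rewrite 1 [← Real.rpow_one h]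
    rw [← Real.rpow_add hh]; congr 1; ring
  rw [← h0]
  exact hc.tendsto.mono_left nhdsWithin_le_nhds

/-- With `q t = (t + ε)(h - t + ε)` the convolution is `α² ∫ q ^ (-1 - α)`. Differentiating `(h -
2t) q ^ (-α)` trades this integral for one of `q ^ (-α)` plus a boundary term. The boundary term
cancels `2 ε ^ (-α) shiftKernel α ε h` up to an error of size `ε ^ (1 - α)`, and the remaining
integral has the positive coefficient `4α - 2`. -/
lemma mixedBound_le (hα : 1 / 2 < α) {ε h : ℝ} (hε : 0 < ε) (hh : 0 < h) :
    mixedBound α ε h ≤ (∫ t in 0..h, shiftKernel α ε t * shiftKernel α ε (h - t))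
      - 2 * ε ^ (-α) * shiftKernel α ε h := by
  have hα0 : 0 < α := by linarith
  set q : ℝ → ℝ := fun t => (t + ε) * (h - t + ε) with hq
  have hqpos : ∀ t ∈ uIcc 0 h, 0 < q t := by
    intro t ht
    rw [uIcc_of_le hh.le] at ht
    exact mul_pos (by linarith [ht.1]) (by linarith [ht.2])
  have hqd : ∀ t, HasDerivAt q (h - 2 * t) t := by
    intro t
    have := ((hasDerivAt_id t).add_const ε).mul (((hasDerivAt_id t).const_sub h).add_const ε)
    refine HasDerivAt.congr_deriv this ?_
    simp only [id]
    ring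
  have hqc : Continuous q := by fun_prop
  have hrc : ∀ r : ℝ, ContinuousOn (fun t => q t ^ r) (uIcc 0 h) := fun r t ht =>
    (hqc.continuousAt.rpow_const (Or.inl (hqpos t ht).ne')).continuousWithinAt
  set L := h + 2 * ε with hL
  have hLpos : 0 < L := by positivity
  set f : ℝ → ℝ := fun t => (h - 2 * t) * q t ^ (-α) with hf
  set f' : ℝ → ℝ := fun t => (4 * α - 2) * q t ^ (-α) - α * L ^ 2 * q t ^ (-1 - α) with hf'
  have hfd : ∀ t ∈ uIcc 0 h, HasDerivAt f (f' t) t := by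
    intro t ht
    have h1 := (hqd t).rpow_const (p := -α) (Or.inl (hqpos t ht).ne')
    have h2 := (((hasDerivAt_id t).const_mul 2).const_sub h).mul h1
    refine HasDerivAt.congr_deriv h2 ?_
    have e1 : q t ^ (-α) = q t * q t ^ (-1 - α) := by
      nth_rewrite 2 [← Real.rpow_one (q t)]
      -- The form of `f'` rests on the identity `(h - 2t)² = L² - 4 q t`.
      rw [← Real.rpow_add (hqpos t ht)]; congr 1; ring
    have e2 : -α - 1 = -1 - α := by ring
    simp only [hf', id, e2]
    rw [e1]
    simp only [hq, hL]
    ring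
  have hf'c : ContinuousOn f' (uIcc 0 h) :=
    (continuousOn_const.mul (hrc _)).sub (continuousOn_const.mul (hrc _))
  have hFTC := intervalIntegral.integral_eq_sub_of_hasDerivAt hfd hf'c.intervalIntegrable
  have hends : f h - f 0 = -(2 * h * (ε * (h + ε)) ^ (-α)) := by
    simp only [hf, hq]
    rw [show (h + ε) * (h - h + ε) = ε * (h + ε) by ring,
      show (0 + ε) * (h - 0 + ε) = ε * (h + ε) by ring]
    ring
  -- Since `q ≤ L² / 4` and `4α - 2 > 0`, the power `q ^ (-α)` may be replaced by its minimal
  -- possible value `(L² / 4) ^ (-α)`; this is the origin of the factor `4 ^ α`.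
  have hint : ((4 * α - 2) * (L ^ 2 / 4) ^ (-α)) * h + 2 * h * (ε * (h + ε)) ^ (-α)
      ≤ α * L ^ 2 * ∫ t in 0..h, q t ^ (-1 - α) := by
    have hm : ∫ t in 0..h, ((4 * α - 2) * (L ^ 2 / 4) ^ (-α) - f' t)
        ≤ ∫ t in 0..h, α * L ^ 2 * q t ^ (-1 - α) := by
      refine intervalIntegral.integral_mono_on hh.le
        (continuousOn_const.sub hf'c).intervalIntegrable
        (continuousOn_const.mul (hrc _)).intervalIntegrable fun t ht => ?_
      have hqt := hqpos t (by rwa [uIcc_of_le hh.le])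
      have hle : q t ≤ L ^ 2 / 4 := by
        simp only [hq, hL]
        nlinarith [sq_nonneg (h - 2 * t)]
      have := Real.rpow_le_rpow_of_nonpos hqt hle (neg_nonpos.2 hα0.le)
      simp only [hf']
      nlinarith
    rw [intervalIntegral.integral_sub intervalIntegrable_const hf'c.intervalIntegrable, hFTC, hends,
      intervalIntegral.integral_const, intervalIntegral.integral_const_mul] at hm
    simp only [sub_zero, smul_eq_mul] at hm
    linarith
  have hK : ∫ t in 0..h, shiftKernel α ε t * shiftKernel α ε (h - t)
      = α ^ 2 * ∫ t in 0..h, q t ^ (-1 - α) := by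
    rw [← intervalIntegral.integral_const_mul]
    refine intervalIntegral.integral_congr fun t ht => ?_
    rw [uIcc_of_le hh.le] at ht
    simp only [shiftKernel, hq]
    rw [Real.mul_rpow (by linarith [ht.1]) (by linarith [ht.2])]
    ring
  rw [hK]
  generalize (∫ t in 0..h, q t ^ (-1 - α)) = J at hint
  have hmul := mul_le_mul_of_nonneg_left hint (show 0 ≤ α / L ^ 2 by positivity)
  have e0 : α / L ^ 2 * (α * L ^ 2 * J) = α ^ 2 * J := by field_simp
  rw [e0] at hmul
  have e1 : (L ^ 2 / 4) ^ (-α) = 4 ^ α * L ^ (-2 * α) := by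
    rw [Real.div_rpow (by positivity) (by norm_num), ← Real.rpow_natCast, ← Real.rpow_mul hLpos.le,
      Real.rpow_neg (by norm_num : (0 : ℝ) ≤ 4)]
    rw [div_inv_eq_mul, mul_comm]
    congr 2
    push_cast; ring
  have e2 : L ^ (-2 - 2 * α) = L ^ (-2 * α) / L ^ 2 := by
    rw [← Real.rpow_natCast, ← Real.rpow_sub hLpos]; congr 1; push_cast; ring
  have hhε : 0 < h + ε := by positivity
  have e3 : (ε * (h + ε)) ^ (-α) = ε ^ (-α) * ((h + ε) ^ (-1 - α) * (h + ε)) := by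
    rw [Real.mul_rpow hε.le hhε.le]
    congr 1
    nth_rewrite 3 [← Real.rpow_one (h + ε)]
    rw [← Real.rpow_add hhε]; congr 1; ring
  have e4 : ε ^ (1 - α) = ε ^ (-α) * ε := by
    nth_rewrite 3 [← Real.rpow_one ε]
    rw [← Real.rpow_add hε]; congr 1; ring
  have e5 : (h + ε) ^ (-2 - α) = (h + ε) ^ (-1 - α) / (h + ε) := by
    rw [← Real.rpow_sub_one hhε.ne']; congr 1; ring
  unfold mixedBound shiftKernel
  rw [← hL, e2, e4, e5]
  rw [e1, e3] at hmul
  have hA : 0 < ε ^ (-α) := by positivity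
  have hB : 0 < (h + ε) ^ (-1 - α) := by positivity
  generalize ε ^ (-α) = A at *
  generalize (h + ε) ^ (-1 - α) = B at *
  generalize L ^ (-2 * α) = C at *
  generalize (4 : ℝ) ^ α = F at *
  refine le_trans ?_ (sub_le_sub_right hmul _)
  -- The relative mismatch between the boundary term and the divergent term, which produces the
  -- constant `8 * α` in `mixedBound`.
  have key : 1 - h * (h + ε) / L ^ 2 ≤ 4 * ε / (h + ε) := by
    rw [← sub_nonneg]
    have : 4 * ε / (h + ε) - (1 - h * (h + ε) / L ^ 2)
        = ε * (h * (h + ε) + 8 * ε * h + 12 * ε ^ 2) / ((h + ε) * L ^ 2) := by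
      field_simp
      simp only [hL]
      ring
    rw [this]
    positivity
  have key2 := mul_le_mul_of_nonneg_left key (show 0 ≤ 2 * α * A * B by positivity)
  have r1 : 2 * α * A * B * (1 - h * (h + ε) / L ^ 2)
      = 2 * A * (α * B) - α / L ^ 2 * (2 * h * (A * (B * (h + ε)))) := by ring
  have r2 : 2 * α * A * B * (4 * ε / (h + ε)) = 8 * α * (A * ε * (B / (h + ε))) := by ring
  rw [r1, r2] at key2
  have r3 : α / L ^ 2 * ((4 * α - 2) * (F * C) * h)
      = 2 * α * (2 * α - 1) * F * (h * (C / L ^ 2)) := by ring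
  rw [mul_add, r3]
  linarith

end MixedKernel

/-! ### Negativity of the mixed inner product -/

section MixedForm

variable {H : Type*} [NormedAddCommGroup H] [InnerProductSpace ℝ H] {γ : ℝ → H} {w : ℝ → ℝ}

/-- Fubini's theorem for the triangle `0 < t < h`. -/
lemma integral_triangle {k : ℝ × ℝ → ℝ}
    (hk : IntegrableOn k {p : ℝ × ℝ | 0 < p.1 ∧ p.1 < p.2}) :
    Integrable (fun h => ∫ t in 0..h, k (t, h)) halfLine ∧
      ∫ p in {p : ℝ × ℝ | 0 < p.1 ∧ p.1 < p.2}, k p = ∫ h, (∫ t in 0..h, k (t, h)) ∂halfLine := by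
  have hS : MeasurableSet {p : ℝ × ℝ | 0 < p.1 ∧ p.1 < p.2} :=
    (measurableSet_lt measurable_const measurable_fst).inter
      (measurableSet_lt measurable_fst measurable_snd)
  rw [← integrable_indicator_iff hS, Measure.volume_eq_prod] at hk
  have hinner : ∀ h, ∫ t, indicator {p : ℝ × ℝ | 0 < p.1 ∧ p.1 < p.2} k (t, h)
      = indicator (Ioi 0) (fun h => ∫ t in 0..h, k (t, h)) h := by
    intro h
    by_cases hh : 0 < h
    · rw [indicator_of_mem (show h ∈ Ioi (0 : ℝ) from hh), intervalIntegral.integral_of_le hh.le,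
        integral_Ioc_eq_integral_Ioo, ← integral_indicator measurableSet_Ioo]
      rfl
    · rw [indicator_of_notMem (show h ∉ Ioi (0 : ℝ) from hh)]
      refine integral_eq_zero_of_ae (Eventually.of_forall fun t => ?_)
      refine indicator_of_notMem (fun ht => hh (ht.1.trans ht.2)) _
  have hi := hk.integral_prod_right
  simp only [hinner] at hi
  refine ⟨(integrable_indicator_iff measurableSet_Ioi).1 hi, ?_⟩
  rw [← integral_indicator hS, Measure.volume_eq_prod, integral_prod_symm _ hk]
  simp only [hinner]
  rw [integral_indicator measurableSet_Ioi]

variable [CompleteSpace H]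

/-- The curves run in opposite directions, so polarisation produces `w (t + τ)`. The terms in `w t`
and `w τ` factor, each giving `ε ^ (-α) ∫ w * shiftKernel α ε`. In the third, `h = t + τ` produces
the convolution of the kernel with itself, and `mixedBound_le` applies pointwise because `w ≥ 0`. -/
lemma mixedBound_le_inner (hγ : IsStationaryCurve γ w) {α ε : ℝ} (hα : 1 / 2 < α) (hα1 : α < 1)
    (hi : Integrable (fun h => w h * h ^ (-1 - 2 * α)) halfLine) (hε : 0 < ε) :
    (∫ h, w h * mixedBound α ε h ∂halfLine) / 2
      ≤ -inner ℝ (marchaud α γ ε) (marchaud α (fun t => γ (-t)) ε) := by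
  have hα0 : 0 < α := by linarith
  have cw := hγ.continuous_incr
  obtain ⟨M, hM⟩ := hγ.bounded_incr
  rw [inner_marchaud_marchaud hγ hγ.comp_neg hα0 hε hε]
  have hin : ∀ p : ℝ × ℝ, inner ℝ (γ 0 - γ p.1) (γ (-0) - γ (-p.2))
      = (w p.1 + w p.2 - w (p.1 + p.2)) / 2 := by
    intro p
    rw [neg_zero, hγ.inner_sub_sub, hγ.even, sub_neg_eq_add]
  simp only [hin]
  have I : ∀ f : ℝ × ℝ → ℝ, Continuous f →
      Integrable (fun p : ℝ × ℝ => shiftKernel α ε p.1 * shiftKernel α ε p.2 * w (f p))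
        (halfLine.prod halfLine) := fun f hf =>
    integrable_shiftKernel_mul_mul hα0 hε hε (cw.comp hf) ⟨M, fun p => hM (f p)⟩
  have i1 := I (fun p => p.1) continuous_fst
  have i2 := I (fun p => p.2) continuous_snd
  have i3 := I (fun p => p.1 + p.2) (continuous_fst.add continuous_snd)
  rw [integral_mul_half_add_sub i1 i2 i3]
  have e1 : ∫ p : ℝ × ℝ, shiftKernel α ε p.1 * shiftKernel α ε p.2 * w p.1
      ∂(halfLine.prod halfLine) = ε ^ (-α) * ∫ h, w h * shiftKernel α ε h ∂halfLine := by
    rw [← integral_shiftKernel hα0 hε, mul_comm, ← integral_prod_mul]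
    refine integral_congr_ae (Eventually.of_forall fun p => ?_)
    simp only
    ring
  have e2 : ∫ p : ℝ × ℝ, shiftKernel α ε p.1 * shiftKernel α ε p.2 * w p.2
      ∂(halfLine.prod halfLine) = ε ^ (-α) * ∫ h, w h * shiftKernel α ε h ∂halfLine := by
    rw [← integral_shiftKernel hα0 hε, ← integral_prod_mul]
    refine integral_congr_ae (Eventually.of_forall fun p => ?_)
    simp only
    ring
  set k : ℝ × ℝ → ℝ := fun p => shiftKernel α ε p.1 * shiftKernel α ε (p.2 - p.1) * w p.2 with hk
  have hshear : (fun p : ℝ × ℝ => shiftKernel α ε p.1 * shiftKernel α ε p.2 * w (p.1 + p.2))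
      = fun p => k (p.1, p.1 + p.2) := by
    funext p
    simp [hk]
  have i3' := i3
  rw [hshear, integrable_shear_iff] at i3'
  obtain ⟨it, et⟩ := integral_triangle i3'
  have e3 : ∫ p : ℝ × ℝ, shiftKernel α ε p.1 * shiftKernel α ε p.2 * w (p.1 + p.2)
      ∂(halfLine.prod halfLine) = ∫ h, (∫ t in 0..h, k (t, h)) ∂halfLine := by
    rw [hshear, setIntegral_shear, et]
  rw [e1, e2, e3]
  have iw : Integrable (fun h => w h * shiftKernel α ε h) halfLine :=
    (integrable_shiftKernel hα0 hε).bdd_mul cw.aestronglyMeasurable (Eventually.of_forall hM)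
  have ib : Integrable (fun h => w h * mixedBound α ε h) halfLine := by
    refine (hi.const_mul (2 * α * (2 * α - 1) * 4 ^ α + 8 * α)).mono'
      (cw.measurable.mul (measurable_mixedBound α ε)).aestronglyMeasurable ?_
    filter_upwards [ae_restrict_mem measurableSet_Ioi] with h hh
    rw [norm_mul, Real.norm_of_nonneg (hγ.nonneg h), mul_left_comm]
    exact mul_le_mul_of_nonneg_left (abs_mixedBound_le hα hα1 hε hh) (hγ.nonneg h)
  have hle : ∫ h, w h * mixedBound α ε h ∂halfLine
      ≤ ∫ h, ((∫ t in 0..h, k (t, h)) - 2 * ε ^ (-α) * (w h * shiftKernel α ε h)) ∂halfLine := by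
    refine integral_mono_ae ib (it.sub (iw.const_mul _)) ?_
    filter_upwards [ae_restrict_mem measurableSet_Ioi] with h hh
    have := mul_le_mul_of_nonneg_left (mixedBound_le hα hε hh) (hγ.nonneg h)
    simp only [hk]
    rw [intervalIntegral.integral_mul_const]
    linarith
  rw [integral_sub it (iw.const_mul _), integral_const_mul] at hle
  linarith

/-- The mixed product of the two one-sided Marchaud derivatives is negative. -/
theorem le_neg_inner_of_tendsto_marchaud (hγ : IsStationaryCurve γ w) {α : ℝ} (hα : 1 / 2 < α)
    (hα1 : α < 1) (hi : Integrable (fun h => w h * h ^ (-1 - 2 * α)) halfLine) {G G' : H}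
    (hG : Tendsto (fun ε => marchaud α γ ε) (𝓝[>] 0) (𝓝 G))
    (hG' : Tendsto (fun ε => marchaud α (fun t => γ (-t)) ε) (𝓝[>] 0) (𝓝 G')) :
    α * (2 * α - 1) * 4 ^ α * (∫ h, w h * h ^ (-1 - 2 * α) ∂halfLine) ≤ -inner ℝ G G' := by
  have hR : Tendsto (fun ε => -inner ℝ (marchaud α γ ε) (marchaud α (fun t => γ (-t)) ε))
      (𝓝[>] 0) (𝓝 (-inner ℝ G G')) := (hG.inner hG').neg
  have hL : Tendsto (fun ε => ∫ h, w h * mixedBound α ε h ∂halfLine) (𝓝[>] 0)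
      (𝓝 (∫ h, w h * (2 * α * (2 * α - 1) * 4 ^ α * h ^ (-1 - 2 * α)) ∂halfLine)) := by
    refine tendsto_integral_filter_of_dominated_convergence
      (fun h => (2 * α * (2 * α - 1) * 4 ^ α + 8 * α) * (w h * h ^ (-1 - 2 * α)))
      (Eventually.of_forall fun ε =>
        (hγ.continuous_incr.measurable.mul (measurable_mixedBound α ε)).aestronglyMeasurable)
      ?_ (hi.const_mul _) ?_
    · filter_upwards [self_mem_nhdsWithin] with ε hε
      filter_upwards [ae_restrict_mem measurableSet_Ioi] with h hh
      rw [norm_mul, Real.norm_of_nonneg (hγ.nonneg h), mul_left_comm]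
      exact mul_le_mul_of_nonneg_left (abs_mixedBound_le hα hα1 hε hh) (hγ.nonneg h)
    · filter_upwards [ae_restrict_mem measurableSet_Ioi] with h hh
      exact (tendsto_mixedBound hα1 hh).const_mul _
  have hle := le_of_tendsto_of_tendsto (hL.div_const 2) hR
    (by filter_upwards [self_mem_nhdsWithin] with ε hε
        exact mixedBound_le_inner hγ hα hα1 hi hε)
  refine le_trans (le_of_eq ?_) hle
  rw [← integral_const_mul, ← integral_div]
  refine integral_congr_ae (Eventually.of_forall fun h => ?_)
  simp only
  ring

end MixedForm

/-! ### Translates in `L²(ℝ)` as a stationary curve -/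

section Translation

variable {u v : ℝ → ℝ}

lemma memLp_translate (hu : MemLp u 2 volume) (t : ℝ) :
    MemLp (fun x => u (x - t)) 2 volume :=
  hu.comp_measurePreserving (measurePreserving_sub_right volume t)

/-- The translates of `u` as a curve in `L²(ℝ)`. -/
def translateLp (hu : MemLp u 2 volume) (t : ℝ) : Lp ℝ 2 (volume : Measure ℝ) :=
  (memLp_translate hu t).toLp _

lemma coeFn_translateLp (hu : MemLp u 2 volume) (t : ℝ) :
    translateLp hu t =ᵐ[volume] fun x => u (x - t) :=
  (memLp_translate hu t).coeFn_toLp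

lemma continuous_translateLp (hu : MemLp u 2 volume) : Continuous (translateLp hu) := by
  let g : C(ℝ, C(ℝ, ℝ)) := (ContinuousMap.mk (fun a : ℝ × ℝ => a.2 - a.1)
    (continuous_snd.sub continuous_fst)).curry
  have := (continuous_const (y := hu.toLp u)).compMeasurePreservingLp g.continuous
    (fun t => measurePreserving_sub_right volume t) (by simp)
  exact this

lemma inner_toLp {f g : ℝ → ℝ} (hf : MemLp f 2 volume) (hg : MemLp g 2 volume) :
    inner ℝ (hf.toLp f) (hg.toLp g) = ∫ x, f x * g x := by
  rw [L2.inner_def]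
  refine integral_congr_ae ?_
  filter_upwards [hf.coeFn_toLp, hg.coeFn_toLp] with x h1 h2
  rw [h1, h2]
  simp [mul_comm]

/-- The squared `L²` norm of the increments of `u`. -/
def incr (u : ℝ → ℝ) (h : ℝ) : ℝ := ∫ x, (u (x - h) - u x) ^ 2

lemma norm_translateLp_sub_sq (hu : MemLp u 2 volume) (a b : ℝ) :
    ‖translateLp hu a - translateLp hu b‖ ^ 2 = incr u (a - b) := by
  have hd := (memLp_translate hu a).sub (memLp_translate hu b)
  have e : translateLp hu a - translateLp hu b = hd.toLp _ := (MemLp.toLp_sub _ _).symm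
  rw [e, ← real_inner_self_eq_norm_sq, inner_toLp, incr,
    ← integral_sub_right_eq_self (fun x => (u (x - (a - b)) - u x) ^ 2) b]
  refine integral_congr_ae (Eventually.of_forall fun x => ?_)
  simp only [Pi.sub_apply]
  rw [show x - b - (a - b) = x - a by ring]
  ring

lemma isStationaryCurve_translateLp (hu : MemLp u 2 volume) :
    IsStationaryCurve (translateLp hu) (incr u) where
  continuous := continuous_translateLp hu
  bounded := by
    refine ⟨‖hu.toLp u‖, fun t => le_of_eq ?_⟩
    exact Lp.norm_compMeasurePreserving (hu.toLp u) (measurePreserving_sub_right volume t)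
  norm_sub_sq := norm_translateLp_sub_sq hu

lemma translateLp_sub (hu : MemLp u 2 volume) (hv : MemLp v 2 volume) (t : ℝ) :
    translateLp (hu.sub hv) t = translateLp hu t - translateLp hv t :=
  MemLp.toLp_sub (memLp_translate hu t) (memLp_translate hv t)

end Translation

/-! ### The Slobodeckij norm in terms of increments -/

section Seminorm

variable {α : ℝ} {u : ℝ → ℝ}

/-- Substitute `y = x + h` and integrate in `x` first; evenness in `h` accounts for the factor `2`.
-/
lemma integrable_incr_and_integral_slobodeckij (hu : MemHTilde α u) :
    Integrable (fun h => incr u h * h ^ (-1 - 2 * α)) halfLine ∧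
      ∫ p, slobodeckijKernel α u p ∂(volume.prod volume)
        = 2 * ∫ h, incr u h * h ^ (-1 - 2 * α) ∂halfLine := by
  have hst := isStationaryCurve_translateLp hu.1
  have hmp := measurePreserving_prod_add (volume : Measure ℝ) (volume : Measure ℝ)
  have he : MeasurableEmbedding (fun z : ℝ × ℝ => (z.1, z.1 + z.2)) :=
    (MeasurableEquiv.shearAddRight ℝ).measurableEmbedding
  have hI : Integrable (fun z : ℝ × ℝ => slobodeckijKernel α u (z.1, z.1 + z.2))
      (volume.prod volume) := (hmp.integrable_comp_emb he (g := slobodeckijKernel α u)).2 hu.2.2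
  have hE := hmp.integral_comp he (slobodeckijKernel α u)
  have hinner : ∀ h, ∫ x, slobodeckijKernel α u (x, x + h)
      = incr u |h| * |h| ^ (-1 - 2 * α) := by
    intro h
    have h1 : incr u |h| = incr u h := by
      rcases abs_choice h with h' | h' <;> rw [h']
      exact hst.even h
    rw [h1, ← hst.even h, show (-1 - 2 * α) = -(1 + 2 * α) by ring,
      Real.rpow_neg (abs_nonneg h), ← div_eq_mul_inv, incr, ← integral_div]
    refine integral_congr_ae (Eventually.of_forall fun x => ?_)
    simp only [slobodeckijKernel]
    rw [show x - (x + h) = -h by ring, abs_neg, sub_neg_eq_add]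
    congr 1
    ring
  have hr := hI.integral_prod_right
  simp only [hinner] at hr
  refine ⟨?_, ?_⟩
  · refine (hr.restrict (s := Ioi 0)).congr ?_
    filter_upwards [ae_restrict_mem measurableSet_Ioi] with h hh
    rw [abs_of_pos hh]
  · rw [← hE, integral_prod_symm _ hI]
    simp only [hinner]
    exact integral_comp_abs (f := fun h => incr u h * h ^ (-1 - 2 * α))

lemma ae_translate_eq_zero (hu : ∀ᵐ x, x ∉ Omega → u x = 0) (t : ℝ) :
    ∀ᵐ x, x - t ∉ Omega → u (x - t) = 0 :=
  (measurePreserving_sub_right volume t).quasiMeasurePreserving.ae hu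

/-- Beyond distance `1` the function and its translate have disjoint supports, so the cross term
vanishes. -/
lemma incr_of_one_lt (hu : MemHTilde α u) {h : ℝ} (hh : 1 < h) :
    incr u h = 2 * ∫ x, u x ^ 2 := by
  have i1 := (memLp_translate hu.1 h).integrable_sq
  have i2 := hu.1.integrable_sq
  have : incr u h = ∫ x, (u (x - h) ^ 2 + u x ^ 2) := by
    refine integral_congr_ae ?_
    filter_upwards [hu.2.1, ae_translate_eq_zero hu.2.1 h] with x h1 h2
    by_cases hx : x ∈ Omega
    · have : u (x - h) = 0 := h2 (fun h' => by
        have a := hx.2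
        have b := h'.1
        linarith)
      rw [this]; ring
    · rw [h1 hx]; ring
  rw [this, integral_add i1 i2, integral_sub_right_eq_self (fun x => u x ^ 2) h]
  ring

/-- A Poincaré inequality: keep only `h > 1`, where the increment is constant and `∫₁^∞ 2 h ^ (-1 -
2α) dh = 1 / α`. -/
lemma integral_sq_le (hα : 0 < α) (hu : MemHTilde α u) :
    ∫ x, u x ^ 2 ≤ α * ∫ h, incr u h * h ^ (-1 - 2 * α) ∂halfLine := by
  have hst := isStationaryCurve_translateLp hu.1
  have hi := (integrable_incr_and_integral_slobodeckij hu).1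
  have h1 : ∫ h in Ioi (1 : ℝ), incr u h * h ^ (-1 - 2 * α)
      ≤ ∫ h in Ioi (0 : ℝ), incr u h * h ^ (-1 - 2 * α) := by
    refine setIntegral_mono_set hi ?_ (Ioi_subset_Ioi zero_le_one).eventuallyLE
    filter_upwards [ae_restrict_mem measurableSet_Ioi] with h hh
    exact mul_nonneg (hst.nonneg h) (Real.rpow_nonneg (le_of_lt hh) _)
  have h2 : ∫ h in Ioi (1 : ℝ), incr u h * h ^ (-1 - 2 * α)
      = (∫ x, u x ^ 2) / α := by
    rw [setIntegral_congr_fun measurableSet_Ioi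
      (g := fun h => (2 * ∫ x, u x ^ 2) * h ^ (-1 - 2 * α))
      (fun h hh => by simp only [incr_of_one_lt hu hh]), integral_const_mul,
      integral_Ioi_rpow_of_lt (by linarith) one_pos, Real.one_rpow]
    rw [show -1 - 2 * α + 1 = -(2 * α) by ring]
    field_simp
  rw [h2, div_le_iff₀ hα] at h1
  linarith

end Seminorm

/-! ### Supports of the limits -/

section Support

/-- The restriction of `G` to `S` is orthogonal to every regularised integral, hence to `G`, which
makes `∫_S G²` zero. -/
lemma ae_eq_zero_of_tendsto_marchaud {γ : ℝ → Lp ℝ 2 (volume : Measure ℝ)} {w : ℝ → ℝ}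
    (hγ : IsStationaryCurve γ w) {α : ℝ} (hα : 0 < α) {G : Lp ℝ 2 (volume : Measure ℝ)}
    (hG : Tendsto (fun ε => marchaud α γ ε) (𝓝[>] 0) (𝓝 G)) {S : Set ℝ} (hS : MeasurableSet S)
    (hz : ∀ t > 0, ∀ᵐ x, x ∈ S → γ t x = γ 0 x) :
    ∀ᵐ x, x ∈ S → G x = 0 := by
  have hm : MemLp (S.indicator G) 2 volume := (Lp.memLp G).indicator hS
  have hε : ∀ ε > 0, inner ℝ (hm.toLp _) (marchaud α γ ε) = 0 := by
    intro ε hε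
    rw [inner_marchaud hγ hα hε]
    refine integral_eq_zero_of_ae ?_
    filter_upwards [ae_restrict_mem measurableSet_Ioi] with t ht
    have : inner ℝ (hm.toLp _) (γ 0 - γ t) = (0 : ℝ) := by
      rw [L2.inner_def]
      refine integral_eq_zero_of_ae ?_
      filter_upwards [hz t ht, hm.coeFn_toLp, Lp.coeFn_sub (γ 0) (γ t)] with x h1 h2 h3
      rw [h2, h3]
      by_cases hx : x ∈ S
      · simp [h1 hx]
      · simp [hx]
    rw [this, mul_zero]
    rfl
  have hlim : inner ℝ (hm.toLp _) G = (0 : ℝ) := by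
    refine tendsto_nhds_unique ((tendsto_const_nhds (x := hm.toLp _)).inner hG) ?_
    refine tendsto_const_nhds.congr' ?_
    filter_upwards [self_mem_nhdsWithin] with ε h
    exact (hε ε h).symm
  have hself : inner ℝ (hm.toLp _) G = ∫ x, (S.indicator G x) ^ 2 := by
    rw [L2.inner_def]
    refine integral_congr_ae ?_
    filter_upwards [hm.coeFn_toLp] with x h2
    rw [h2]
    by_cases hx : x ∈ S
    · simp [hx, sq]
    · simp [hx]
  rw [hself, integral_eq_zero_iff_of_nonneg (fun x => sq_nonneg _) hm.integrable_sq] at hlim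
  filter_upwards [hlim] with x hx hxS
  simpa [hxS] using hx

end Support

/-! ### Correlations with test functions -/

section Correlation

variable {u φ : ℝ → ℝ}

/-- The correlation of `u` with `φ`. -/
def correlation (u φ : ℝ → ℝ) (t : ℝ) : ℝ := ∫ x, u (x - t) * φ x

lemma correlation_eq_convolution (u φ : ℝ → ℝ) (t : ℝ) :
    correlation u φ t
      = convolution (fun y => u (-y)) φ (ContinuousLinearMap.mul ℝ ℝ) volume t := by
  rw [convolution_def, correlation, ← integral_sub_left_eq_self _ volume t]
  refine integral_congr_ae (Eventually.of_forall fun y => ?_)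
  simp only [ContinuousLinearMap.mul_apply']
  congr 2
  ring

lemma hasDerivAt_correlation (hu : Integrable u) (hφ : ContDiff ℝ ∞ φ) (hc : HasCompactSupport φ)
    (t : ℝ) : HasDerivAt (correlation u φ) (correlation u (deriv φ) t) t := by
  have h := hc.hasDerivAt_convolution_right (ContinuousLinearMap.mul ℝ ℝ) (μ := volume)
    hu.comp_neg.locallyIntegrable (hφ.of_le (by simp)) t
  rw [← correlation_eq_convolution] at h
  exact h.congr_of_eventuallyEq
    (Eventually.of_forall fun s => correlation_eq_convolution u φ s)

lemma exists_abs_correlation_le (hu : Integrable u) (hφ : Continuous φ)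
    (hc : HasCompactSupport φ) : ∃ M, 0 ≤ M ∧ ∀ t, |correlation u φ t| ≤ M := by
  obtain ⟨C, hC⟩ := hc.exists_bound_of_continuous hφ
  refine ⟨|C| * ∫ x, |u x|, by positivity, fun t => ?_⟩
  rw [← integral_sub_right_eq_self (fun x => |u x|) t, ← integral_const_mul]
  refine (abs_integral_le_integral_abs).trans (integral_mono_of_nonneg
    (Eventually.of_forall fun x => abs_nonneg _)
    ((hu.comp_sub_right t).abs.const_mul _) (Eventually.of_forall fun x => ?_))
  simp only
  rw [abs_mul, mul_comm]
  exact mul_le_mul_of_nonneg_right ((hC x).trans (le_abs_self C)) (abs_nonneg _)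

lemma correlation_eq_zero (hu : ∀ᵐ x, x ∉ Omega → u x = 0) (hφ : ∀ x ∉ Omega, φ x = 0) {t : ℝ}
    (ht : 1 ≤ |t|) : correlation u φ t = 0 := by
  refine integral_eq_zero_of_ae ?_
  filter_upwards [ae_translate_eq_zero hu t] with x hx
  by_cases h : x ∈ Omega
  · have : u (x - t) = 0 := hx fun h' => by
      have a := h.1
      have b := h.2
      have c := h'.1
      have d := h'.2
      have : |t| < 1 := abs_lt.2 ⟨by linarith, by linarith⟩
      linarith
    simp [this]
  · simp [hφ x h]

end Correlation

/-! ### The truncated Abel kernel -/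

section TruncKernel

/-- The kernel `t ^ (-α)` on the unit interval. -/
def truncKernel (α : ℝ) : ℝ → ℝ := indicator (Ioo 0 1) (fun t => t ^ (-α))

lemma integrable_truncKernel {α : ℝ} (hα : α < 1) : Integrable (truncKernel α) := by
  rw [truncKernel, integrable_indicator_iff measurableSet_Ioo]
  have := intervalIntegral.intervalIntegrable_rpow' (a := 0) (b := 1) (r := -α) (by linarith)
  rwa [intervalIntegrable_iff_integrableOn_Ioo_of_le zero_le_one] at this

lemma integral_halfLine_eq_truncKernel {α : ℝ} {f : ℝ → ℝ} (hf : ∀ t, 1 ≤ t → f t = 0) :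
    ∫ t, t ^ (-α) * f t ∂halfLine = ∫ t, truncKernel α t * f t := by
  rw [halfLine, ← integral_indicator measurableSet_Ioi]
  congr 1
  funext t
  by_cases h0 : 0 < t
  · by_cases h1 : t < 1
    · simp [truncKernel, h0, h1]
    · simp [h0, hf t (not_lt.1 h1)]
  · simp [truncKernel, h0]

end TruncKernel

/-! ### Integration by parts and passage to the limit -/

section WeakDerivative

variable {u φ : ℝ → ℝ} {α σ : ℝ}

/-- Integration by parts for the regularised kernel. -/
lemma integral_shiftKernel_mul_sub (hα : 0 < α) {ε : ℝ} (hε : 0 < ε) {r r' : ℝ → ℝ}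
    (hr : ∀ t, HasDerivAt r (r' t) t) (hr'c : Continuous r')
    (hb : ∃ M, ∀ t, |r t| ≤ M) (hs : ∀ t, 1 ≤ t → r' t = 0) :
    ∫ t, shiftKernel α ε t * (r 0 - r t) ∂halfLine
      = -∫ t, (t + ε) ^ (-α) * r' t ∂halfLine := by
  obtain ⟨M, hM⟩ := hb
  have hrc : Continuous r := continuous_iff_continuousAt.2 fun t => (hr t).continuousAt
  have hpow : ContinuousOn (fun t : ℝ => (t + ε) ^ (-α)) (Ici 0) := fun t ht =>
    ContinuousAt.continuousWithinAt (ContinuousAt.rpow_const (by fun_prop)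
      (Or.inl (by have : 0 ≤ t := ht; positivity)))
  have hbd : ∀ t, ‖r 0 - r t‖ ≤ M + M := fun t =>
    (norm_sub_le _ _).trans (add_le_add (hM _) (hM _))
  -- The primitive `-(t + ε) ^ (-α)` vanishes at infinity, where `r` is bounded, and `r 0 - r t`
  -- vanishes at `0`, so neither end contributes.
  have h := integral_Ioi_mul_deriv_eq_deriv_mul (a := 0) (a' := 0) (b' := 0)
    (u := fun t => -(t + ε) ^ (-α)) (u' := shiftKernel α ε)
    (v := fun t => r 0 - r t) (v' := fun t => -r' t)
    (fun t ht => ?_) (fun t _ => (hr t).const_sub (r 0)) ?_ ?_ ?_ ?_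
  · have e : ∫ t in Ioi 0, -(t + ε) ^ (-α) * -r' t = ∫ t in Ioi 0, (t + ε) ^ (-α) * r' t := by
      congr 1
      funext t
      ring
    rw [e] at h
    rw [halfLine]
    linarith
  · have ht0 : 0 < t + ε := by have : 0 < t := ht; positivity
    have h1 := (((hasDerivAt_id t).add_const ε).rpow_const (p := -α) (Or.inl ht0.ne')).neg
    refine h1.congr_deriv ?_
    simp only [id, shiftKernel]
    rw [show -α - 1 = -1 - α by ring]
    ring
  · have hz : IntegrableOn (fun t => -(t + ε) ^ (-α) * -r' t) (Icc 0 1) :=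
      ContinuousOn.integrableOn_Icc
        (((hpow.mono Icc_subset_Ici_self).neg).mul hr'c.neg.continuousOn)
    refine (hz.of_forall_sdiff_eq_zero measurableSet_Ioi fun t ht => ?_)
    have : 1 ≤ t := by
      by_contra hlt
      exact ht.2 ⟨le_of_lt ht.1, (not_le.1 hlt).le⟩
    simp [hs t this]
  · exact (integrable_shiftKernel hα hε).mul_bdd
      (continuous_const.sub hrc).aestronglyMeasurable (Eventually.of_forall hbd)
  · have h1 : Tendsto (fun t => -(t + ε) ^ (-α) * (r 0 - r t)) (𝓝 0)
        (𝓝 (-(0 + ε) ^ (-α) * (r 0 - r 0))) := by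
      refine ContinuousAt.tendsto (ContinuousAt.mul (ContinuousAt.neg
        (ContinuousAt.rpow_const (by fun_prop) (Or.inl (by simpa using hε.ne')))) ?_)
      exact (continuous_const.sub hrc).continuousAt
    rw [sub_self, mul_zero] at h1
    exact h1.mono_left nhdsWithin_le_nhds
  · have h1 : Tendsto (fun t : ℝ => -(t + ε) ^ (-α)) atTop (𝓝 0) := by
      have := ((tendsto_rpow_neg_atTop hα).comp (tendsto_atTop_add_const_right atTop ε
        tendsto_id)).neg
      simpa using this
    exact h1.zero_mul_isBoundedUnder_le (isBoundedUnder_of ⟨M + M, hbd⟩)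

lemma tendsto_integral_shift_rpow (hα : 0 < α) (hα1 : α < 1) {f : ℝ → ℝ} (hf : Continuous f)
    (hb : ∃ M, ∀ t, |f t| ≤ M) (hs : ∀ t, 1 ≤ t → f t = 0) :
    Tendsto (fun ε => ∫ t, (t + ε) ^ (-α) * f t ∂halfLine) (𝓝[>] 0)
      (𝓝 (∫ t, t ^ (-α) * f t ∂halfLine)) := by
  obtain ⟨M, hM⟩ := hb
  refine tendsto_integral_filter_of_dominated_convergence (fun t => truncKernel α t * M)
    (Eventually.of_forall fun ε => ?_) ?_
    ((integrable_truncKernel hα1).restrict.mul_const M) ?_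
  · have := hf.measurable
    exact Measurable.aestronglyMeasurable (by fun_prop)
  · filter_upwards [self_mem_nhdsWithin] with ε (hε : 0 < ε)
    filter_upwards [ae_restrict_mem measurableSet_Ioi] with t (ht : 0 < t)
    by_cases h1 : t < 1
    · rw [norm_mul, Real.norm_of_nonneg (by positivity), truncKernel,
        indicator_of_mem (show t ∈ Ioo (0 : ℝ) 1 from ⟨ht, h1⟩)]
      exact mul_le_mul (Real.rpow_le_rpow_of_nonpos ht (by linarith) (by linarith)) (hM t)
        (norm_nonneg _) (by positivity)
    · simp [truncKernel, hs t (not_lt.1 h1), h1]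
  · filter_upwards [ae_restrict_mem measurableSet_Ioi] with t (ht : 0 < t)
    refine Tendsto.mul_const _ ?_
    have hc : ContinuousAt (fun ε : ℝ => (t + ε) ^ (-α)) 0 :=
      ContinuousAt.rpow_const (by fun_prop) (Or.inl (by simpa using ht.ne'))
    have := hc.tendsto.mono_left (nhdsWithin_le_nhds (s := Ioi 0))
    simpa using this

/-- The convolution of `u` with a truncated one-sided kernel. -/
def truncConv (α σ : ℝ) (u : ℝ → ℝ) : ℝ → ℝ :=
  convolution (fun t => truncKernel α (σ * t)) u (ContinuousLinearMap.mul ℝ ℝ) volume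

lemma integrable_truncKernel_mul (hα1 : α < 1) (hσ : σ ≠ 0) :
    Integrable (fun t => truncKernel α (σ * t)) :=
  (integrable_truncKernel hα1).comp_mul_left' hσ

lemma integrable_truncConv (hα1 : α < 1) (hσ : σ ≠ 0) (hu : Integrable u) :
    Integrable (truncConv α σ u) :=
  (integrable_truncKernel_mul hα1 hσ).integrable_convolution _ hu

lemma integral_truncConv_mul (hα1 : α < 1) (hσ : σ ≠ 0) (hu : Integrable u) {ψ : ℝ → ℝ}
    (hψ : Continuous ψ) (hb : ∃ M, ∀ x, ‖ψ x‖ ≤ M) :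
    ∫ x, truncConv α σ u x * ψ x = ∫ t, truncKernel α (σ * t) * correlation u ψ t := by
  obtain ⟨M, hM⟩ := hb
  have hi := (integrable_truncKernel_mul hα1 hσ).convolution_integrand
    (ContinuousLinearMap.mul ℝ ℝ) (μ := volume) hu
  have hi2 : Integrable (fun p : ℝ × ℝ => truncKernel α (σ * p.2) * u (p.1 - p.2) * ψ p.1)
      (volume.prod volume) :=
    hi.mul_bdd (hψ.comp continuous_fst).aestronglyMeasurable
      (Eventually.of_forall fun p => hM p.1)
  have hsw := integral_integral_swap (f := fun x t => truncKernel α (σ * t) * u (x - t) * ψ x) hi2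
  have e1 : ∀ x, truncConv α σ u x * ψ x
      = ∫ t, truncKernel α (σ * t) * u (x - t) * ψ x := fun x => by
    rw [integral_mul_const]
    rfl
  simp only [e1, correlation]
  rw [hsw]
  congr 1
  funext t
  rw [← integral_const_mul]
  simp only [mul_assoc]

end WeakDerivative

/-! ### Marchaud limits are Riemann–Liouville derivatives -/

section RiemannLiouville

variable {u v : ℝ → ℝ} {α σ : ℝ}

lemma MemHTilde.integrable (hu : MemHTilde α u) : Integrable u := by
  have hΩ : MeasurableSet Omega := measurableSet_Ioo
  have : IsFiniteMeasure (volume.restrict Omega) := by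
    unfold Omega
    infer_instance
  have h1 : IntegrableOn u Omega := (hu.1.restrict Omega).integrable (by norm_num)
  refine ((integrable_indicator_iff hΩ).2 h1).congr ?_
  filter_upwards [hu.2.1] with x hx
  by_cases h : x ∈ Omega
  · simp [h]
  · simp [h, hx h]

/-- Pairing with `φ` reduces the vector-valued integral to a scalar one for the correlation of `u`
with `φ`. Integration by parts replaces the kernel by `(t + ε) ^ (-α)`, integrable in the limit near
`0` because `α < 1`, and puts the derivative on `φ`; Fubini then restores the convolution. The sign
`σ` selects the side. -/
lemma integral_mul_eq_of_tendsto_marchaud (hα : 0 < α) (hα1 : α < 1) (hσ : σ = 1 ∨ σ = -1)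
    (hu : MemHTilde α u) {γ : ℝ → Lp ℝ 2 (volume : Measure ℝ)}
    (hst : IsStationaryCurve γ (incr u)) (hγ : ∀ t, γ t = translateLp hu.1 (σ * t))
    {G : Lp ℝ 2 (volume : Measure ℝ)}
    (hG : Tendsto (fun ε => marchaud α γ ε) (𝓝[>] 0) (𝓝 G)) {φ : ℝ → ℝ} (hφ : ContDiff ℝ ∞ φ)
    (hc : HasCompactSupport φ) (hs : tsupport φ ⊆ Omega) :
    ∫ x, G x * φ x = -(σ * ∫ x, truncConv α σ u x * deriv φ x) := by
  have hσ0 : σ ≠ 0 := by rcases hσ with rfl | rfl <;> norm_num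
  have hσa : |σ| = 1 := by rcases hσ with rfl | rfl <;> simp
  have hui := hu.integrable
  have hφL : MemLp φ 2 volume := hφ.continuous.memLp_of_hasCompactSupport hc
  have hdc : Continuous (deriv φ) := hφ.continuous_deriv (by simp)
  have hdz : ∀ x ∉ Omega, deriv φ x = 0 := fun x hx =>
    image_eq_zero_of_notMem_tsupport fun h => hx (hs (tsupport_deriv_subset h))
  have hd1 : ContDiff ℝ ∞ (deriv φ) := (contDiff_infty_iff_deriv.1 hφ).2
  have hr1c : Continuous (correlation u (deriv φ)) := continuous_iff_continuousAt.2 fun t =>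
    (hasDerivAt_correlation hui hd1 hc.deriv t).continuousAt
  set r' : ℝ → ℝ := fun t => σ * correlation u (deriv φ) (σ * t) with hr'
  have hRd : ∀ t, HasDerivAt (fun t => correlation u φ (σ * t)) (r' t) t := by
    intro t
    have h1 := (hasDerivAt_correlation hui hφ hc (σ * t)).comp t ((hasDerivAt_id t).const_mul σ)
    refine h1.congr_deriv ?_
    simp only [hr', mul_one]
    ring
  have hr'c : Continuous r' := continuous_const.mul (hr1c.comp (continuous_const.mul continuous_id))
  have hr's : ∀ t, 1 ≤ t → r' t = 0 := by
    intro t ht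
    simp only [hr']
    rw [correlation_eq_zero hu.2.1 hdz
      (by rw [abs_mul, hσa, one_mul]; exact ht.trans (le_abs_self t)), mul_zero]
  obtain ⟨M, _, hM⟩ := exists_abs_correlation_le hui hφ.continuous hc
  obtain ⟨M', _, hM'⟩ := exists_abs_correlation_le hui hdc hc.deriv
  have hin : ∀ t, inner ℝ (hφL.toLp φ) (γ 0 - γ t)
      = correlation u φ (σ * 0) - correlation u φ (σ * t) := by
    intro t
    rw [inner_sub_right, hγ, hγ, translateLp, translateLp, inner_toLp, inner_toLp]
    simp only [correlation, mul_comm (φ _)]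
  have hε : ∀ ε > 0, inner ℝ (hφL.toLp φ) (marchaud α γ ε)
      = -∫ t, (t + ε) ^ (-α) * r' t ∂halfLine := by
    intro ε hε
    rw [inner_marchaud hst hα hε]
    simp only [hin]
    exact integral_shiftKernel_mul_sub hα hε hRd hr'c ⟨M, fun t => hM _⟩ hr's
  have hlim : Tendsto (fun ε => -∫ t, (t + ε) ^ (-α) * r' t ∂halfLine) (𝓝[>] 0)
      (𝓝 (-∫ t, t ^ (-α) * r' t ∂halfLine)) := by
    refine (tendsto_integral_shift_rpow hα hα1 hr'c ⟨M', fun t => ?_⟩ hr's).neg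
    rw [abs_mul, hσa, one_mul]
    exact hM' _
  have hlim2 : Tendsto (fun ε => inner ℝ (hφL.toLp φ) (marchaud α γ ε)) (𝓝[>] 0)
      (𝓝 (inner ℝ (hφL.toLp φ) G)) := (tendsto_const_nhds (x := hφL.toLp φ)).inner hG
  have heq : inner ℝ (hφL.toLp φ) G = -∫ t, t ^ (-α) * r' t ∂halfLine := by
    refine tendsto_nhds_unique hlim2 (hlim.congr' ?_)
    filter_upwards [self_mem_nhdsWithin] with ε h
    exact (hε ε h).symm
  have hG' : inner ℝ (hφL.toLp φ) G = ∫ x, G x * φ x := by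
    rw [L2.inner_def]
    refine integral_congr_ae ?_
    filter_upwards [hφL.coeFn_toLp] with x hx
    rw [hx]
    simp
  obtain ⟨C, hC⟩ := hc.deriv.exists_bound_of_continuous hdc
  rw [← hG', heq, integral_halfLine_eq_truncKernel hr's,
    integral_truncConv_mul hα1 hσ0 hui hdc ⟨C, hC⟩, ← integral_const_mul]
  congr 1
  rcases hσ with rfl | rfl
  · simp [hr']
  -- On the right side the reflection `t ↦ -t` matches the orientation of the kernel.
  · rw [← integral_neg_eq_self]
    simp only [hr']
    refine integral_congr_ae (Eventually.of_forall fun t => ?_)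
    simp only [neg_mul, one_mul, neg_neg]
    ring

lemma isWeakDerivOn_of_tendsto_marchaud (hα : 0 < α) (hα1 : α < 1) (hσ : σ = 1 ∨ σ = -1)
    (hu : MemHTilde α u) {γ : ℝ → Lp ℝ 2 (volume : Measure ℝ)}
    (hst : IsStationaryCurve γ (incr u)) (hγ : ∀ t, γ t = translateLp hu.1 (σ * t))
    {G : Lp ℝ 2 (volume : Measure ℝ)}
    (hG : Tendsto (fun ε => marchaud α γ ε) (𝓝[>] 0) (𝓝 G)) (c : ℝ) {F : ℝ → ℝ}
    (hF : ∀ x ∈ Omega, F x = c * truncConv α σ u x) :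
    IsWeakDerivOn F (fun x => σ * (c * G x)) Omega := by
  have hσ0 : σ ≠ 0 := by rcases hσ with rfl | rfl <;> norm_num
  have hσ2 : σ * σ = 1 := by rcases hσ with rfl | rfl <;> norm_num
  have hΩ : MeasurableSet Omega := measurableSet_Ioo
  refine ⟨?_, ?_, fun φ hφ hc hs => ?_⟩
  · refine IntegrableOn.locallyIntegrableOn ?_
    refine IntegrableOn.congr_fun (f := fun x => c * truncConv α σ u x) ?_
      (fun x hx => (hF x hx).symm) hΩ
    exact ((integrable_truncConv hα1 hσ0 hu.integrable).const_mul c).integrableOn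
  · have : LocallyIntegrable (fun x => σ * (c * G x)) := by
      have h := (Lp.memLp G).locallyIntegrable (by norm_num)
      exact (h.smul c).smul σ
    exact this.locallyIntegrableOn _
  · have hdz : ∀ x ∉ Omega, deriv φ x = 0 := fun x hx =>
      image_eq_zero_of_notMem_tsupport fun h => hx (hs (tsupport_deriv_subset h))
    have hz : ∀ x ∉ Omega, φ x = 0 := fun x hx =>
      image_eq_zero_of_notMem_tsupport fun h => hx (hs h)
    have e1 : ∫ x in Omega, F x * deriv φ x = c * ∫ x, truncConv α σ u x * deriv φ x := by
      rw [setIntegral_congr_fun hΩ (g := fun x => c * (truncConv α σ u x * deriv φ x))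
        (fun x hx => by simp only [hF x hx, mul_assoc]), integral_const_mul,
        setIntegral_eq_integral_of_forall_compl_eq_zero (fun x hx => by rw [hdz x hx, mul_zero])]
    have e2 : ∫ x in Omega, σ * (c * G x) * φ x = σ * c * ∫ x, G x * φ x := by
      rw [setIntegral_eq_integral_of_forall_compl_eq_zero
        (fun x hx => by rw [hz x hx, mul_zero]), ← integral_const_mul]
      simp only [mul_assoc]
    rw [e1, e2, integral_mul_eq_of_tendsto_marchaud hα hα1 hσ hu hst hγ hG hφ hc hs]
    linear_combination (-c * ∫ x, truncConv α σ u x * deriv φ x) * hσ2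

/-- For `x ∈ Omega` only distances below `1` occur, so the truncation is invisible, and the
vanishing of `u` off `Omega` supplies the integration limit. -/
lemma leftFracIntegral_eq_truncConv (hu : ∀ᵐ x, x ∉ Omega → u x = 0) {x : ℝ} (hx : x ∈ Omega) :
    leftFracIntegral 0 (1 - α) u x = 1 / Real.Gamma (1 - α) * truncConv α 1 u x := by
  have hx0 : 0 < x := hx.1
  have hx1 : x < 1 := hx.2
  rw [leftFracIntegral, truncConv, convolution_def]
  congr 1
  have h := intervalIntegral.integral_comp_sub_left
    (fun y => (x - y) ^ (1 - α - 1) * u y) (a := 0) (b := x) x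
  rw [sub_self, sub_zero] at h
  rw [← h, intervalIntegral.integral_of_le hx0.le, ← integral_indicator measurableSet_Ioc]
  refine integral_congr_ae ?_
  filter_upwards [(Measure.measurePreserving_sub_left volume x).quasiMeasurePreserving.ae hu,
    compl_mem_ae_iff.2 (measure_singleton x)] with t ht htx
  have htx' : t ≠ x := htx
  simp only [one_mul, truncKernel, ContinuousLinearMap.mul_apply', sub_sub_cancel]
  by_cases h1 : t ∈ Ioo (0 : ℝ) x
  · rw [indicator_of_mem (Ioo_subset_Ioc_self h1),
      indicator_of_mem (show t ∈ Ioo (0 : ℝ) 1 from ⟨h1.1, h1.2.trans hx1⟩)]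
    congr 2
    ring
  · rw [indicator_of_notMem (fun h2 => h1 ⟨h2.1, lt_of_le_of_ne h2.2 htx'⟩)]
    by_cases h3 : t ∈ Ioo (0 : ℝ) 1
    · rw [ht fun h4 => h1 ⟨h3.1, by linarith [h4.1]⟩, mul_zero]
    · rw [indicator_of_notMem h3, zero_mul]

lemma rightFracIntegral_eq_truncConv (hu : ∀ᵐ x, x ∉ Omega → u x = 0) {x : ℝ} (hx : x ∈ Omega) :
    rightFracIntegral 1 (1 - α) u x = 1 / Real.Gamma (1 - α) * truncConv α (-1) u x := by
  have hx0 : 0 < x := hx.1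
  have hx1 : x < 1 := hx.2
  rw [rightFracIntegral, truncConv, convolution_def]
  congr 1
  have h := intervalIntegral.integral_comp_add_left
    (fun y => (y - x) ^ (1 - α - 1) * u y) (a := 0) (b := 1 - x) x
  rw [add_zero, add_sub_cancel] at h
  rw [← h, intervalIntegral.integral_of_le (by linarith), ← integral_indicator measurableSet_Ioc,
    ← integral_neg_eq_self]
  refine integral_congr_ae ?_
  filter_upwards [(Measure.measurePreserving_sub_left volume x).quasiMeasurePreserving.ae hu,
    compl_mem_ae_iff.2 (measure_singleton (x - 1))] with t ht htx
  have htx' : t ≠ x - 1 := htx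
  simp only [truncKernel, ContinuousLinearMap.mul_apply', neg_mul, one_mul]
  by_cases h1 : -t ∈ Ioo (0 : ℝ) (1 - x)
  · rw [indicator_of_mem (Ioo_subset_Ioc_self h1),
      indicator_of_mem (show -t ∈ Ioo (0 : ℝ) 1 from ⟨h1.1, by linarith [h1.2]⟩)]
    rw [add_sub_cancel_left, ← sub_eq_add_neg]
    congr 2
    ring
  · rw [indicator_of_notMem (fun h2 => h1 ⟨h2.1, lt_of_le_of_ne h2.2 fun h5 => htx' (by linarith)⟩)]
    by_cases h3 : -t ∈ Ioo (0 : ℝ) 1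
    · rw [ht fun h4 => h1 ⟨h3.1, by linarith [h4.2]⟩, mul_zero]
    · rw [indicator_of_notMem h3, zero_mul]

/-- The fundamental lemma of the calculus of variations. It makes the choice in `leftRLDeriv` and
`rightRLDeriv` immaterial. -/
lemma IsWeakDerivOn.ae_eq {F g₁ g₂ : ℝ → ℝ} {U : Set ℝ} (hU : IsOpen U)
    (h₁ : IsWeakDerivOn F g₁ U) (h₂ : IsWeakDerivOn F g₂ U) : g₁ =ᵐ[volume.restrict U] g₂ := by
  have h := hU.ae_eq_zero_of_integral_contDiff_smul_eq_zero (h₁.2.1.sub h₂.2.1)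
    (fun φ hφ hc hs => ?_)
  · rw [EventuallyEq, ae_restrict_iff' hU.measurableSet]
    filter_upwards [h] with x hx hxU
    exact sub_eq_zero.1 (hx hxU)
  · have hint : ∀ {g : ℝ → ℝ}, LocallyIntegrableOn g U →
        IntegrableOn (fun x => g x * φ x) U := by
      intro g hg
      have hk : IntegrableOn g (tsupport φ) := hg.integrableOn_compact_subset hs hc
      obtain ⟨C, hC⟩ := hc.exists_bound_of_continuous hφ.continuous
      have hk2 : IntegrableOn (fun x => g x * φ x) (tsupport φ) :=
        hk.mul_bdd hφ.continuous.aestronglyMeasurable (Eventually.of_forall hC)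
      refine hk2.of_forall_sdiff_eq_zero hU.measurableSet fun x hx => ?_
      rw [image_eq_zero_of_notMem_tsupport hx.2, mul_zero]
    have e := (h₁.2.2 φ hφ hc hs).symm.trans (h₂.2.2 φ hφ hc hs)
    rw [← setIntegral_eq_integral_of_forall_compl_eq_zero (s := U) (fun x hx => by
      rw [image_eq_zero_of_notMem_tsupport (fun h => hx (hs h)), zero_smul])]
    have e2 : ∫ x in U, φ x • (g₁ - g₂) x = (∫ x in U, g₁ x * φ x) - ∫ x in U, g₂ x * φ x := by
      rw [← integral_sub (hint h₁.2.1) (hint h₂.2.1)]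
      congr 1
      funext x
      simp only [Pi.sub_apply, smul_eq_mul]
      ring
    rw [e2]
    linarith

lemma leftRLDeriv_ae_eq {g : ℝ → ℝ} (h : HasLeftRLDeriv α u g) :
    leftRLDeriv α u =ᵐ[volume.restrict Omega] g := by
  have hex : ∃ g, HasLeftRLDeriv α u g := ⟨g, h⟩
  rw [leftRLDeriv, dif_pos hex]
  exact hex.choose_spec.2.ae_eq isOpen_Ioo h.2

lemma rightRLDeriv_ae_eq {g : ℝ → ℝ} (h : HasRightRLDeriv α u g) :
    rightRLDeriv α u =ᵐ[volume.restrict Omega] g := by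
  have hex : ∃ g, HasRightRLDeriv α u g := ⟨g, h⟩
  rw [rightRLDeriv, dif_pos hex]
  filter_upwards [hex.choose_spec.2.ae_eq isOpen_Ioo h.2] with x hx
  exact neg_injective hx

lemma MemHTilde.hasLeftRLDeriv (hα : 0 < α) (hα1 : α < 1) (hu : MemHTilde α u)
    {G : Lp ℝ 2 (volume : Measure ℝ)}
    (hG : Tendsto (fun ε => marchaud α (translateLp hu.1) ε) (𝓝[>] 0) (𝓝 G)) :
    HasLeftRLDeriv α u (fun x => 1 / Real.Gamma (1 - α) * G x) := by
  refine ⟨((Lp.memLp G).restrict Omega).const_mul _, ?_⟩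
  have := isWeakDerivOn_of_tendsto_marchaud hα hα1 (Or.inl rfl) hu
    (isStationaryCurve_translateLp hu.1) (fun t => by rw [one_mul]) hG
    (1 / Real.Gamma (1 - α)) (fun x hx => leftFracIntegral_eq_truncConv hu.2.1 hx)
  simpa only [one_mul] using this

lemma MemHTilde.hasRightRLDeriv (hα : 0 < α) (hα1 : α < 1) (hu : MemHTilde α u)
    {G : Lp ℝ 2 (volume : Measure ℝ)}
    (hG : Tendsto (fun ε => marchaud α (fun t => translateLp hu.1 (-t)) ε) (𝓝[>] 0) (𝓝 G)) :
    HasRightRLDeriv α u (fun x => 1 / Real.Gamma (1 - α) * G x) := by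
  refine ⟨((Lp.memLp G).restrict Omega).const_mul _, ?_⟩
  have := isWeakDerivOn_of_tendsto_marchaud hα hα1 (Or.inr rfl) hu
    (isStationaryCurve_translateLp hu.1).comp_neg (fun t => by rw [neg_one_mul]) hG
    (1 / Real.Gamma (1 - α)) (fun x hx => rightFracIntegral_eq_truncConv hu.2.1 hx)
  simpa only [neg_one_mul] using this

end RiemannLiouville

/-! ### The bilinear form: linearity and coercivity -/

section Form

variable {u v : ℝ → ℝ} {α : ℝ}

lemma MemHTilde.sub (hu : MemHTilde α u) (hv : MemHTilde α v) : MemHTilde α (u - v) := by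
  refine ⟨hu.1.sub hv.1, ?_, ?_⟩
  · filter_upwards [hu.2.1, hv.2.1] with x h1 h2 hx
    simp [h1 hx, h2 hx]
  · have hm : AEStronglyMeasurable (slobodeckijKernel α (u - v)) (volume.prod volume) := by
      have hw := (hu.1.sub hv.1).aestronglyMeasurable.aemeasurable
      have h1 : AEMeasurable (fun p : ℝ × ℝ => (u - v) p.1) (volume.prod volume) :=
        hw.comp_quasiMeasurePreserving Measure.quasiMeasurePreserving_fst
      have h2 : AEMeasurable (fun p : ℝ × ℝ => (u - v) p.2) (volume.prod volume) :=
        hw.comp_quasiMeasurePreserving Measure.quasiMeasurePreserving_snd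
      have h3 : Measurable (fun p : ℝ × ℝ => |p.1 - p.2| ^ (1 + 2 * α)) := by fun_prop
      exact (((h1.sub h2).pow_const 2).div h3.aemeasurable).aestronglyMeasurable
    refine ((hu.2.2.const_mul 2).add (hv.2.2.const_mul 2)).mono' hm
      (Eventually.of_forall fun p => ?_)
    simp only [slobodeckijKernel, Pi.sub_apply, Pi.add_apply]
    rw [Real.norm_of_nonneg (by positivity), ← mul_div_assoc, ← mul_div_assoc, ← add_div]
    gcongr
    nlinarith [sq_nonneg ((u p.1 - u p.2) + (v p.1 - v p.2))]

lemma MemHTilde.exists_tendsto_left (hα : 0 < α) (hα1 : α < 1) (hu : MemHTilde α u) :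
    ∃ G : Lp ℝ 2 (volume : Measure ℝ),
      Tendsto (fun ε => marchaud α (translateLp hu.1) ε) (𝓝[>] 0) (𝓝 G) :=
  exists_tendsto_marchaud (isStationaryCurve_translateLp hu.1) hα hα1
    (integrable_incr_and_integral_slobodeckij hu).1

lemma MemHTilde.exists_tendsto_right (hα : 0 < α) (hα1 : α < 1) (hu : MemHTilde α u) :
    ∃ G : Lp ℝ 2 (volume : Measure ℝ),
      Tendsto (fun ε => marchaud α (fun t => translateLp hu.1 (-t)) ε) (𝓝[>] 0) (𝓝 G) :=
  exists_tendsto_marchaud (isStationaryCurve_translateLp hu.1).comp_neg hα hα1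
    (integrable_incr_and_integral_slobodeckij hu).1

lemma MemHTilde.translateLp_eq (hu : MemHTilde α u) {t : ℝ} {S : Set ℝ}
    (hS : ∀ x ∈ S, x ∉ Omega ∧ x - t ∉ Omega) :
    ∀ᵐ x, x ∈ S → translateLp hu.1 t x = translateLp hu.1 0 x := by
  filter_upwards [coeFn_translateLp hu.1 t, coeFn_translateLp hu.1 0, hu.2.1,
    ae_translate_eq_zero hu.2.1 t] with x h1 h2 h3 h4 hx
  rw [h1, h2, sub_zero, h3 (hS x hx).1, h4 (hS x hx).2]

/-- For `x ≤ 0` and `t > 0` both `x` and `x - t` lie outside `Omega`, so the increments vanish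
there. -/
lemma MemHTilde.ae_eq_zero_left (hα : 0 < α) (hu : MemHTilde α u)
    {G : Lp ℝ 2 (volume : Measure ℝ)}
    (hG : Tendsto (fun ε => marchaud α (translateLp hu.1) ε) (𝓝[>] 0) (𝓝 G)) :
    ∀ᵐ x, x ∈ Iic (0 : ℝ) → G x = 0 := by
  refine ae_eq_zero_of_tendsto_marchaud (isStationaryCurve_translateLp hu.1) hα hG
    measurableSet_Iic fun t ht => hu.translateLp_eq fun x (hx : x ≤ 0) => ⟨fun h => ?_, fun h => ?_⟩
  · linarith [h.1]
  · linarith [h.1]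

lemma MemHTilde.ae_eq_zero_right (hα : 0 < α) (hu : MemHTilde α u)
    {G : Lp ℝ 2 (volume : Measure ℝ)}
    (hG : Tendsto (fun ε => marchaud α (fun t => translateLp hu.1 (-t)) ε) (𝓝[>] 0) (𝓝 G)) :
    ∀ᵐ x, x ∈ Ici (1 : ℝ) → G x = 0 := by
  refine ae_eq_zero_of_tendsto_marchaud (isStationaryCurve_translateLp hu.1).comp_neg hα hG
    measurableSet_Ici fun t ht => ?_
  rw [neg_zero]
  refine hu.translateLp_eq fun x (hx : 1 ≤ x) => ⟨fun h => ?_, fun h => ?_⟩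
  · linarith [h.2]
  · linarith [h.2]

/-- The bilinear form as an inner product of Marchaud derivatives in `L²(ℝ)`. -/
lemma formA_eq_inner {s : ℝ} (hs1 : 1 < s) (hs2 : s < 2) (hu : MemHTilde (s / 2) u)
    (hv : MemHTilde (s / 2) v) {G G' : Lp ℝ 2 (volume : Measure ℝ)}
    (hG : Tendsto (fun ε => marchaud (s / 2) (translateLp hu.1) ε) (𝓝[>] 0) (𝓝 G))
    (hG' : Tendsto (fun ε => marchaud (s / 2) (fun t => translateLp hv.1 (-t)) ε) (𝓝[>] 0)
      (𝓝 G')) :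
    formA s u v = (1 / Real.Gamma (1 - s / 2)) ^ 2 * -inner ℝ G G' := by
  have hα : 0 < s / 2 := by linarith
  have hα1 : s / 2 < 1 := by linarith
  have e1 : ∫ x in Omega, leftRLDeriv (s / 2) u x * rightRLDeriv (s / 2) v x
      = ∫ x in Omega, (1 / Real.Gamma (1 - s / 2)) ^ 2 * (G x * G' x) := by
    refine integral_congr_ae ?_
    filter_upwards [leftRLDeriv_ae_eq (hu.hasLeftRLDeriv hα hα1 hG),
      rightRLDeriv_ae_eq (hv.hasRightRLDeriv hα hα1 hG')] with x h1 h2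
    rw [h1, h2]
    ring
  -- Neither factor need vanish off `Omega` by itself; the product does, through `G` on the left and
  -- `G'` on the right.
  have e2 : ∫ x in Omega, G x * G' x = ∫ x, G x * G' x := by
    refine setIntegral_eq_integral_of_ae_compl_eq_zero ?_
    filter_upwards [hu.ae_eq_zero_left hα hG, hv.ae_eq_zero_right hα hG'] with x h1 h2 hx
    by_cases h0 : x ≤ 0
    · rw [h1 h0, zero_mul]
    · rw [h2 (not_lt.1 fun h3 => hx ⟨not_le.1 h0, h3⟩), mul_zero]
  have e3 : inner ℝ G G' = ∫ x, G x * G' x := by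
    rw [L2.inner_def]
    simp [mul_comm]
  rw [formA, e1, integral_const_mul, e2, e3]
  ring

lemma tendsto_marchaud_sub (hα : 0 < α) (hu : MemHTilde α u) (hv : MemHTilde α v)
    (huv : MemHTilde α (u - v)) {G G' : Lp ℝ 2 (volume : Measure ℝ)}
    (hG : Tendsto (fun ε => marchaud α (translateLp hu.1) ε) (𝓝[>] 0) (𝓝 G))
    (hG' : Tendsto (fun ε => marchaud α (translateLp hv.1) ε) (𝓝[>] 0) (𝓝 G')) :
    Tendsto (fun ε => marchaud α (translateLp huv.1) ε) (𝓝[>] 0) (𝓝 (G - G')) := by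
  refine (hG.sub hG').congr' ?_
  filter_upwards [self_mem_nhdsWithin] with ε hε
  rw [marchaud, marchaud, marchaud,
    ← integral_sub ((isStationaryCurve_translateLp hu.1).integrable hα hε)
      ((isStationaryCurve_translateLp hv.1).integrable hα hε)]
  congr 1
  funext t
  rw [translateLp_sub hu.1 hv.1, translateLp_sub hu.1 hv.1, ← smul_sub]
  congr 1
  abel

/-- The chosen derivatives need not be linear pointwise; linearity passes through the `L²` limits.
-/
lemma formA_sub_left {s : ℝ} (hs1 : 1 < s) (hs2 : s < 2) (hu : MemHTilde (s / 2) u)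
    (hv : MemHTilde (s / 2) v) {f : ℝ → ℝ} (hf : MemHTilde (s / 2) f) :
    formA s (u - v) f = formA s u f - formA s v f := by
  have hα : 0 < s / 2 := by linarith
  have hα1 : s / 2 < 1 := by linarith
  obtain ⟨G, hG⟩ := hu.exists_tendsto_left hα hα1
  obtain ⟨K, hK⟩ := hv.exists_tendsto_left hα hα1
  obtain ⟨F, hF⟩ := hf.exists_tendsto_right hα hα1
  rw [formA_eq_inner hs1 hs2 hu hf hG hF, formA_eq_inner hs1 hs2 hv hf hK hF,
    formA_eq_inner hs1 hs2 (hu.sub hv) hf (tendsto_marchaud_sub hα hu hv (hu.sub hv) hG hK) hF,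
    inner_sub_left]
  ring

/-- Coercivity with an explicit constant. -/
lemma coercive_formA {s : ℝ} (hs1 : 1 < s) (hs2 : s < 2) (hu : MemHTilde (s / 2) u) :
    (1 / Real.Gamma (1 - s / 2)) ^ 2 * (s / 2 * (s - 1) * 4 ^ (s / 2)) / (s / 2 + 2)
      * hTildeNorm (s / 2) u ^ 2 ≤ formA s u u := by
  have hα : 0 < s / 2 := by linarith
  have hα1 : s / 2 < 1 := by linarith
  obtain ⟨G, hG⟩ := hu.exists_tendsto_left hα hα1
  obtain ⟨F, hF⟩ := hu.exists_tendsto_right hα hα1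
  obtain ⟨hi, hsemi⟩ := integrable_incr_and_integral_slobodeckij hu
  have hle := le_neg_inner_of_tendsto_marchaud (isStationaryCurve_translateLp hu.1)
    (by linarith) hα1 hi hG hF
  have hP := integral_sq_le hα hu
  have hsq0 : 0 ≤ ∫ x, u x ^ 2 := integral_nonneg fun x => sq_nonneg _
  rw [formA_eq_inner hs1 hs2 hu hu hG hF, hTildeNorm, hsemi]
  generalize (∫ h, incr u h * h ^ (-1 - 2 * (s / 2)) ∂halfLine) = I at *
  have hI : 0 ≤ I := nonneg_of_mul_nonneg_right (hsq0.trans hP) hα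
  rw [Real.sq_sqrt (by positivity)]
  have hs0 : 0 < s - 1 := by linarith
  rw [show 2 * (s / 2) - 1 = s - 1 by ring] at hle
  -- The denominator comes from `‖u‖² ≤ (s / 2) * I` and the squared semi-norm `2 * I`.
  calc (1 / Real.Gamma (1 - s / 2)) ^ 2 * (s / 2 * (s - 1) * 4 ^ (s / 2)) / (s / 2 + 2)
      * ((∫ x, u x ^ 2) + 2 * I)
      ≤ (1 / Real.Gamma (1 - s / 2)) ^ 2 * (s / 2 * (s - 1) * 4 ^ (s / 2)) / (s / 2 + 2)
      * ((s / 2 + 2) * I) := by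
        gcongr
        linarith
    _ = (1 / Real.Gamma (1 - s / 2)) ^ 2 * (s / 2 * (s - 1) * 4 ^ (s / 2) * I) := by
        field_simp
    _ ≤ _ := by gcongr

lemma hTildeNorm_sq_pos (hu : MemHTilde α u) (h : ¬ u =ᵐ[volume] 0) :
    0 < hTildeNorm α u ^ 2 := by
  have h1 : 0 ≤ ∫ p, slobodeckijKernel α u p ∂(volume.prod volume) :=
    integral_nonneg fun p => by
      unfold slobodeckijKernel
      positivity
  have h2 : 0 ≤ ∫ x, u x ^ 2 := integral_nonneg fun x => sq_nonneg _
  have h3 : (∫ x, u x ^ 2) ≠ 0 := by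
    rw [Ne, integral_eq_zero_iff_of_nonneg (fun x => sq_nonneg _) hu.1.integrable_sq]
    refine fun h' => h ?_
    filter_upwards [h'] with x hx
    simpa using hx
  rw [hTildeNorm, Real.sq_sqrt (by positivity)]
  have := lt_of_le_of_ne h2 h3.symm
  linarith

end Form

end FracBVP

end

theorem theorem3p1 (s : ℝ) (hs1 : 1 < s) (hs2 : s < 2) :
    -- both fractional derivatives of order `s / 2` exist in `L²(0,1)`, so `A` is defined
    (∀ u : ℝ → ℝ, FracBVP.MemHTilde (s / 2) u →
      (∃ g, FracBVP.HasLeftRLDeriv (s / 2) u g) ∧ ∃ g, FracBVP.HasRightRLDeriv (s / 2) u g) ∧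
    -- coercivity
    (∃ c : ℝ, 0 < c ∧ ∀ u : ℝ → ℝ, FracBVP.MemHTilde (s / 2) u →
      c * FracBVP.hTildeNorm (s / 2) u ^ 2 ≤ FracBVP.formA s u u) ∧
    -- monotonicity, strict for distinct elements
    (∀ u v : ℝ → ℝ, FracBVP.MemHTilde (s / 2) u → FracBVP.MemHTilde (s / 2) v →
      0 ≤ FracBVP.formA s u (u - v) - FracBVP.formA s v (u - v) ∧
      (¬ u =ᵐ[MeasureTheory.volume] v →
        0 < FracBVP.formA s u (u - v) - FracBVP.formA s v (u - v))) := by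
  have hα : 0 < s / 2 := by linarith
  have hα1 : s / 2 < 1 := by linarith
  have hc : 0 < (1 / Real.Gamma (1 - s / 2)) ^ 2 * (s / 2 * (s - 1) * 4 ^ (s / 2))
      / (s / 2 + 2) := by
    have h1 : 0 < Real.Gamma (1 - s / 2) := Real.Gamma_pos_of_pos (by linarith)
    have h2 : 0 < s - 1 := by linarith
    positivity
  refine ⟨fun u hu => ?_, ⟨_, hc, fun u hu => FracBVP.coercive_formA hs1 hs2 hu⟩,
    fun u v hu hv => ?_⟩
  · obtain ⟨G, hG⟩ := hu.exists_tendsto_left hα hα1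
    obtain ⟨F, hF⟩ := hu.exists_tendsto_right hα hα1
    exact ⟨⟨_, hu.hasLeftRLDeriv hα hα1 hG⟩, ⟨_, hu.hasRightRLDeriv hα hα1 hF⟩⟩
  · have huv := hu.sub hv
    -- The difference is the form at `(u - v, u - v)`, so coercivity settles both claims.
    rw [← FracBVP.formA_sub_left hs1 hs2 hu hv huv]
    have hco := FracBVP.coercive_formA hs1 hs2 huv
    refine ⟨(mul_nonneg hc.le (sq_nonneg _)).trans hco, fun hne => ?_⟩
    refine (mul_pos hc (FracBVP.hTildeNorm_sq_pos huv fun h0 => hne ?_)).trans_le hco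
    filter_upwards [h0] with x hx
    exact sub_eq_zero.1 hx
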